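/- Let $V$ be a discrete set and, for each $n\in\mathbb N=\{0,1,2,\dots\}$, let $\Gamma_n=(V,E_n,r_n,s_n)$ be a directed graph with vertex set $V$, a discrete set of edges $E_n$, and range and source maps $r_n,s_n\colon E_n\to V$. Let $E_0=V$ and $r_0=s_0=\mathrm{id}_V$. For $n,m\in\mathbb N$ let \[ E_n\times_{s,r}E_m=\{(x,y)\in E_n\times E_m : s_n(x)=r_m(y)\}\to E_{n+m},\qquad (x,y)\mapsto x\cdot y, \] be injective maps with $r_{n+m}(x\cdot y)=r_n(x)$ and $s_{n+m}(x\cdot y)=s_m(y)$, which are associative and for which $r(x)\cdot x=x=x\cdot s(x)$ for all edges $x$. Then $E=\bigsqcup_{n\in\mathbb N}E_n$ is a category with object set $V$. Let $A=\mathrm C_0(V)$. Let $\mathcal H_n$ be the $A,A$-correspondence obtained by completing $\mathrm C_c(E_n)$ for the inner product $\langle x,y\rangle(v)=\sum_{s_n(e)=v}\overline{x(e)}\,y(e)$, with the bimodule structure $(a\cdot x\cdot b)(e)=a(r_n(e))\,x(e)\,b(s_n(e))$; so $\mathcal H_0=A$. Let $\mu_{n,m}\colon\mathcal H_n\otimes_A\mathcal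 H_m\hookrightarrow\mathcal H_{n+m}$ be the isometric bimodule map with $\mu_{n,m}(\delta_x\otimes\delta_y)=\delta_{x\cdot y}$ if $s_n(x)=r_m(y)$ and $\mu_{n,m}(\delta_x\otimes\delta_y)=0$ otherwise. Then $(A,\mathcal H_n,\mu_{n,m})_{n,m\in\mathbb N}$ is a weak partial product system over $\mathbb N$, that is, the $\mathcal H_n$ are $A,A$-correspondences with $\mathcal H_0=A$ and the $\mu_{n,m}$ are associative isometric bimodule maps which, for $n=0$ or $m=0$, are given by the bimodule structure. A weak partial product system is called a \emph{partial product system} if its Fock representation exists and is a representation. This means the following. Let $\mathcal F=\bigoplus_{n\in\mathbb N}\mathcal H_n$ be the Hilbert $A$-module direct sum and $\mathbb B(\mathcal F)$ the $\mathrm C^*$-algebra of adjointable operators on $\mathcal F$. There are linear maps $S_n\colon\mathcal H_n\to\mathbb B(\mathcal F)$ with $S_n(x)y=\mu_{n,m}(x\otimes y)\in\mathcal H_{n+m}$ for all $n,m\in\mathbb N$, $x\in\mathcal H_n$, $y\in\mathcal H_m$, and these satisfy \begin{enumerate} \item $S_n(x)S_m(y)=S_{n+m}(\mu_{n,m}(x\otimes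 y))$ for all $n,m\in\mathbb N$, $x\in\mathcal H_n$, $y\in\mathcal H_m$; \item $S_n(x)^*S_n(y)=S_0(\langle x,y\rangle)$ for all $n\in\mathbb N$, $x,y\in\mathcal H_n$; \item $S_n(\mathcal H_n)^*\cdot S_m(\mathcal H_m)\subseteq S_{m-n}(\mathcal H_{m-n})\cdot\mathbb B(\mathcal F)$ for all $m>n>0$; \item $S_n(\mathcal H_n)^*\cdot S_m(\mathcal H_m)\subseteq S_{n-m}(\mathcal H_{n-m})^*\cdot\mathbb B(\mathcal F)$ for all $n>m>0$; \end{enumerate} here $X\cdot Y$ denotes the closed linear span of the products $xy$ with $x\in X$, $y\in Y$. \textbf{Proposition.} The weak partial product system $(A,\mathcal H_n,\mu_{n,m})$ built from $(E_n)_{n\in\mathbb N}$ is a partial product system if and only if the category $E=\bigsqcup_{n\in\mathbb N}E_n$ is isomorphic to the path category of some directed graph $\Gamma$. No condition is imposed on the degrees of the generators: it is also equivalent that there are a directed graph $\Gamma$, a function $d$ that assigns to each edge of $\Gamma$ an arbitrary degree $d(e)\in\{1,2,3,\dots\}$, and an isomorphism of categories from the path category of $\Gamma$ to $E$ that maps each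 path $e_1e_2\dotsm e_k$ to an arrow in $E_{d(e_1)+\dots+d(e_k)}$. -/

import Mathlib

set_option linter.unusedSectionVars false

open scoped ZeroAtInfty

universe u v w

namespace PPS

noncomputable section

/-- `B` is a positive semidefinite `A`-valued inner product, conjugate-linear in the first
variable, compatible with a right multiplication `R` by elements of the C⋆-algebra `A`.
An element of `A` is positive if it is of the form `star b * b`. -/
structure IsSemiInner {A : Type u} [NonUnitalCStarAlgebra A] {E : Type v} [AddCommGroup E]
    [Module ℂ E] (B : E →ₗ⋆[ℂ] E →ₗ[ℂ] A) (R : E → A → E) : Prop where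
  star_apply : ∀ x y, star (B x y) = B y x
  pos : ∀ x, ∃ b, B x x = star b * b
  rmul : ∀ x y a, B x (R y a) = B x y * a

section semi

variable {A : Type u} [NonUnitalCStarAlgebra A]

theorem norm_le_of_pos {a c : A} (ha : ∃ b, a = star b * b) (hc : ∃ b, c = star b * b) :
    ‖a‖ ≤ ‖a + c‖ := by
  let _ := CStarAlgebra.spectralOrder A
  have _ := CStarAlgebra.spectralOrderedRing A
  have h1 : 0 ≤ a := CStarAlgebra.nonneg_iff_eq_star_mul_self.2 ha
  have h2 : 0 ≤ c := CStarAlgebra.nonneg_iff_eq_star_mul_self.2 hc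
  exact CStarAlgebra.norm_le_norm_of_nonneg_of_le h1 (le_add_of_nonneg_right h2)

theorem sum_pos_form {ι : Type w} (s : Finset ι) (f : ι → A) (h : ∀ i, ∃ b, f i = star b * b) :
    ∃ b, ∑ i ∈ s, f i = star b * b := by
  let _ := CStarAlgebra.spectralOrder A
  have _ := CStarAlgebra.spectralOrderedRing A
  exact CStarAlgebra.nonneg_iff_eq_star_mul_self.1
    (Finset.sum_nonneg fun i _ => CStarAlgebra.nonneg_iff_eq_star_mul_self.2 (h i))

theorem tsum_pos_form {ι : Type w} (f : ι → A) (h : ∀ i, ∃ b, f i = star b * b) :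
    ∃ b, ∑' i, f i = star b * b := by
  let _ := CStarAlgebra.spectralOrder A
  have _ := CStarAlgebra.spectralOrderedRing A
  exact CStarAlgebra.nonneg_iff_eq_star_mul_self.1
    (tsum_nonneg fun i => CStarAlgebra.nonneg_iff_eq_star_mul_self.2 (h i))

variable {E : Type v} [AddCommGroup E] [Module ℂ E]
  {B : E →ₗ⋆[ℂ] E →ₗ[ℂ] A} {R : E → A → E}

theorem IsSemiInner.rmul_left (h : IsSemiInner B R) (x y : E) (a : A) :
    B (R x a) y = star a * B x y := by
  rw [← h.star_apply, h.rmul, star_mul, h.star_apply]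

theorem IsSemiInner.cs (h : IsSemiInner B R) (x y : E) :
    ‖B x y‖ ^ 2 ≤ ‖B x x‖ * ‖B y y‖ := by
  let _ := CStarAlgebra.spectralOrder A
  have _ := CStarAlgebra.spectralOrderedRing A
  have key : ∀ c : ℝ, ‖B x x‖ < c → ‖B x y‖ ^ 2 ≤ c * ‖B y y‖ := by
    intro c hc
    have hc0 : 0 < c := (norm_nonneg _).trans_lt hc
    have hpos : ∀ z, 0 ≤ B z z := fun z =>
      CStarAlgebra.nonneg_iff_eq_star_mul_self.2 (h.pos z)
    have h1 : 0 ≤ B (R x (B x y) - (c : ℂ) • y) (R x (B x y) - (c : ℂ) • y) := hpos _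
    have h2 : B (R x (B x y) - (c : ℂ) • y) (R x (B x y) - (c : ℂ) • y) =
        star (B x y) * B x x * B x y - c • (star (B x y) * B x y)
          - c • (star (B x y) * B x y) + c • c • B y y := by
      simp only [map_sub, LinearMap.sub_apply, h.rmul, h.rmul_left, map_smul,
        LinearMap.map_smulₛₗ, LinearMap.smul_apply, Complex.conj_ofReal]
      rw [← h.star_apply x y]
      simp only [mul_assoc, Complex.coe_smul]
      simp only [smul_sub]
      abel
    have h3 : star (B x y) * B x x * B x y ≤ c • (star (B x y) * B x y) := by
      refine (CStarAlgebra.star_left_conjugate_le_norm_smul (a := B x y)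
        (hb := .of_nonneg (hpos x))).trans ?_
      exact smul_le_smul_of_nonneg_right hc.le (star_mul_self_nonneg _)
    rw [h2] at h1
    have h4 : c • (star (B x y) * B x y) ≤ c • c • B y y := by
      have := h1.trans (add_le_add_left (sub_le_sub_right (sub_le_sub_right h3 _) _) _)
      rw [sub_self, zero_sub, neg_add_eq_sub] at this
      exact sub_nonneg.1 this
    rw [smul_le_smul_iff_of_pos_left hc0] at h4
    have h5 := CStarAlgebra.norm_le_norm_of_nonneg_of_le (star_mul_self_nonneg _) h4
    rw [CStarRing.norm_star_mul_self, norm_smul, Real.norm_of_nonneg hc0.le] at h5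
    rw [pow_two]; exact h5
  have hlim : Filter.Tendsto (fun c : ℝ => c * ‖B y y‖) (nhdsWithin ‖B x x‖ (Set.Ioi ‖B x x‖))
      (nhds (‖B x x‖ * ‖B y y‖)) :=
    ((continuous_id.mul continuous_const).tendsto _).mono_left nhdsWithin_le_nhds
  refine ge_of_tendsto hlim ?_
  filter_upwards [self_mem_nhdsWithin] with c hc using key c hc

theorem IsSemiInner.cs_sqrt (h : IsSemiInner B R) (x y : E) :
    ‖B x y‖ ≤ √‖B x x‖ * √‖B y y‖ := by
  rw [← Real.sqrt_mul (norm_nonneg _)]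
  exact Real.le_sqrt_of_sq_le (h.cs x y)

theorem IsSemiInner.triangle (h : IsSemiInner B R) (x y : E) :
    √‖B (x + y) (x + y)‖ ≤ √‖B x x‖ + √‖B y y‖ := by
  refine Real.sqrt_le_iff.2 ⟨by positivity, ?_⟩
  have e : B (x + y) (x + y) = B x x + B x y + (B y x + B y y) := by simp
  have hx := Real.sq_sqrt (norm_nonneg (B x x))
  have hy := Real.sq_sqrt (norm_nonneg (B y y))
  have h1 := h.cs_sqrt x y
  have h2 := h.cs_sqrt y x
  rw [e]
  have := norm_add_le (B x x + B x y) (B y x + B y y)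
  have := norm_add_le (B x x) (B x y)
  have := norm_add_le (B y x) (B y y)
  nlinarith

end semi

/-- A (right) Hilbert module `E` over the C⋆-algebra `A`. The inner product `ip` is
conjugate-linear in the first variable and `A`-linear in the second, `rmul x a` is `x · a`. -/
class HilbertModule (A : Type u) [NonUnitalCStarAlgebra A] (E : Type v) [NormedAddCommGroup E]
    [NormedSpace ℂ E] where
  ip : E →ₗ⋆[ℂ] E →ₗ[ℂ] A
  rmul : E →ₗ[ℂ] A →ₗ[ℂ] E
  rmul_mul : ∀ x a b, rmul x (a * b) = rmul (rmul x a) b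
  star_ip : ∀ x y, star (ip x y) = ip y x
  ip_self_pos : ∀ x, ∃ b, ip x x = star b * b
  ip_rmul : ∀ x y a, ip x (rmul y a) = ip x y * a
  norm_sq : ∀ x, ‖x‖ ^ 2 = ‖ip x x‖
  complete : CompleteSpace E

section hilbert

variable {A : Type u} [NonUnitalCStarAlgebra A] {E : Type v} [NormedAddCommGroup E]
    [NormedSpace ℂ E] [HilbertModule A E]

theorem isSemiInner_ip : IsSemiInner (HilbertModule.ip (A := A) (E := E))
    (fun x a => HilbertModule.rmul x a) :=
  ⟨HilbertModule.star_ip, HilbertModule.ip_self_pos, HilbertModule.ip_rmul⟩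

variable (A) in
theorem norm_eq_sqrt_ip (x : E) : ‖x‖ = √‖HilbertModule.ip (A := A) x x‖ := by
  rw [← HilbertModule.norm_sq, Real.sqrt_sq (norm_nonneg _)]

theorem norm_ip_le (x y : E) : ‖HilbertModule.ip (A := A) x y‖ ≤ ‖x‖ * ‖y‖ := by
  rw [norm_eq_sqrt_ip A x, norm_eq_sqrt_ip A y]
  exact isSemiInner_ip.cs_sqrt x y

/-- The inner product of a Hilbert module as a continuous sesquilinear map. -/
def ipL : E →L⋆[ℂ] E →L[ℂ] A :=
  LinearMap.mkContinuous₂ (HilbertModule.ip (A := A) (E := E)) 1 fun x y => by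
    simpa using norm_ip_le x y

@[simp] theorem ipL_apply (x y : E) : ipL (A := A) x y = HilbertModule.ip x y := rfl

variable (A) in
theorem ext_ip {x y : E} (h : ∀ z, HilbertModule.ip (A := A) z x = HilbertModule.ip z y) :
    x = y := by
  have h1 : HilbertModule.ip (A := A) (x - y) (x - y) = 0 := by
    rw [map_sub, h, sub_self]
  have h2 := HilbertModule.norm_sq (A := A) (x - y)
  rw [h1, norm_zero, sq_eq_zero_iff, norm_eq_zero] at h2
  exact sub_eq_zero.1 h2

/-! ### The C⋆-algebra of adjointable operators -/

/-- `S` is an adjoint of `T`. -/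
def IsAdj (A : Type u) [NonUnitalCStarAlgebra A] {E : Type v} [NormedAddCommGroup E]
    [NormedSpace ℂ E] [HilbertModule A E] (T S : E →L[ℂ] E) : Prop :=
  ∀ x y, HilbertModule.ip (A := A) (T x) y = HilbertModule.ip x (S y)

theorem IsAdj.symm {T S : E →L[ℂ] E} (h : IsAdj A T S) : IsAdj A S T := fun x y => by
  rw [← HilbertModule.star_ip, ← h, HilbertModule.star_ip]

theorem IsAdj.unique {T S S' : E →L[ℂ] E} (h : IsAdj A T S) (h' : IsAdj A T S') : S = S' := by
  ext y
  exact ext_ip A fun z => by rw [← h, ← h']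

theorem IsAdj.add {T S T' S' : E →L[ℂ] E} (h : IsAdj A T S) (h' : IsAdj A T' S') :
    IsAdj A (T + T') (S + S') := fun x y => by simp [h x y, h' x y]

theorem IsAdj.smul {T S : E →L[ℂ] E} (c : ℂ) (h : IsAdj A T S) :
    IsAdj A (c • T) (star c • S) := fun x y => by simp [h x y]

theorem IsAdj.mul {T S T' S' : E →L[ℂ] E} (h : IsAdj A T S) (h' : IsAdj A T' S') :
    IsAdj A (T * T') (S' * S) := fun x y => by simp [h _ y, h' x]

theorem IsAdj.norm_mul_self_le {T S : E →L[ℂ] E} (h : IsAdj A T S) : ‖T‖ * ‖T‖ ≤ ‖S * T‖ := by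
  have : ‖T‖ ≤ √‖S * T‖ := by
    refine ContinuousLinearMap.opNorm_le_bound _ (Real.sqrt_nonneg _) fun x => ?_
    rw [norm_eq_sqrt_ip A (T x), h]
    refine Real.sqrt_le_iff.2 ⟨by positivity, ?_⟩
    rw [mul_pow, Real.sq_sqrt (norm_nonneg _)]
    calc _ ≤ ‖x‖ * ‖(S * T) x‖ := norm_ip_le x _
      _ ≤ ‖x‖ * (‖S * T‖ * ‖x‖) := by gcongr; exact (S * T).le_opNorm x
      _ = _ := by ring
  calc _ ≤ √‖S * T‖ * √‖S * T‖ := by gcongr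
    _ = _ := Real.mul_self_sqrt (norm_nonneg _)

theorem IsAdj.norm_le {T S : E →L[ℂ] E} (h : IsAdj A T S) : ‖S‖ ≤ ‖T‖ := by
  have h1 := h.symm.norm_mul_self_le.trans (norm_mul_le T S)
  rcases (norm_nonneg S).eq_or_lt with h0 | h0
  · rw [← h0]; exact norm_nonneg _
  · exact le_of_mul_le_mul_right h1 h0

theorem IsAdj.norm_eq {T S : E →L[ℂ] E} (h : IsAdj A T S) : ‖S‖ = ‖T‖ :=
  le_antisymm h.norm_le h.symm.norm_le

end hilbert

section adjointable

variable (A : Type u) [NonUnitalCStarAlgebra A] (E : Type v) [NormedAddCommGroup E]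
    [NormedSpace ℂ E] [HilbertModule A E]

/-- The algebra of adjointable operators on the Hilbert `A`-module `E`. -/
def Adjointable : Subalgebra ℂ (E →L[ℂ] E) where
  carrier := {T | ∃ S, IsAdj A T S}
  mul_mem' := by rintro _ _ ⟨S, h⟩ ⟨S', h'⟩; exact ⟨_, h.mul h'⟩
  add_mem' := by rintro _ _ ⟨S, h⟩ ⟨S', h'⟩; exact ⟨_, h.add h'⟩
  algebraMap_mem' c := ⟨algebraMap ℂ _ (star c), fun x y => by
    simp [Algebra.algebraMap_eq_smul_one]⟩

instance : Star (Adjointable A E) := ⟨fun T => ⟨T.2.choose, T.1, T.2.choose_spec.symm⟩⟩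

variable {A E}

theorem isAdj_star (T : Adjointable A E) : IsAdj A (T : E →L[ℂ] E) (star T : Adjointable A E) :=
  T.2.choose_spec

theorem star_eq_of_isAdj {T S : Adjointable A E} (h : IsAdj A (T : E →L[ℂ] E) S) : star T = S :=
  Subtype.ext ((isAdj_star T).unique h)

variable (A E)

instance : StarRing (Adjointable A E) where
  star_involutive T := star_eq_of_isAdj (isAdj_star T).symm
  star_mul T S := star_eq_of_isAdj ((isAdj_star T).mul (isAdj_star S))
  star_add T S := star_eq_of_isAdj ((isAdj_star T).add (isAdj_star S))

instance : StarModule ℂ (Adjointable A E) where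
  star_smul c T := star_eq_of_isAdj ((isAdj_star T).smul c)

instance : CStarRing (Adjointable A E) where
  norm_mul_self_le T := (isAdj_star T).norm_mul_self_le

instance : CompleteSpace (Adjointable A E) := by
  have _ : CompleteSpace E := HilbertModule.complete A
  refine IsComplete.completeSpace_coe (s := (Adjointable A E : Set (E →L[ℂ] E)))
    (IsClosed.isComplete ?_)
  rw [← isSeqClosed_iff_isClosed]
  intro T T' hT hlim
  choose S hS using hT
  have hsub : ∀ m n, IsAdj A (T m - T n) (S m - S n) := fun m n x y => by
    simp [hS m x y, hS n x y]
  have hc : CauchySeq S := by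
    refine Metric.cauchySeq_iff.2 fun ε hε => ?_
    obtain ⟨N, hN⟩ := Metric.cauchySeq_iff.1 hlim.cauchySeq ε hε
    refine ⟨N, fun m hm n hn => ?_⟩
    have := hN m hm n hn
    rwa [dist_eq_norm, (hsub m n).norm_eq, ← dist_eq_norm]
  obtain ⟨S', hS'⟩ := cauchySeq_tendsto_of_complete hc
  refine ⟨S', fun x y => ?_⟩
  have h1 : Filter.Tendsto (fun n => HilbertModule.ip (A := A) (T n x) y) Filter.atTop
      (nhds (HilbertModule.ip (T' x) y)) := by
    have : Continuous fun L : E →L[ℂ] E => ipL (A := A) (L x) y := by fun_prop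
    exact (this.tendsto T').comp hlim
  have h2 : Filter.Tendsto (fun n => HilbertModule.ip (A := A) x (S n y)) Filter.atTop
      (nhds (HilbertModule.ip x (S' y))) := by
    have : Continuous fun L : E →L[ℂ] E => ipL (A := A) x (L y) := by fun_prop
    exact (this.tendsto S').comp hS'
  refine tendsto_nhds_unique h1 (h2.congr fun n => (hS n x y).symm)

/-- The adjointable operators on a Hilbert module form a C⋆-algebra for the operator norm. -/
instance : CStarAlgebra (Adjointable A E) where

end adjointable
/-! ### Hilbert module direct sums -/

section sum

variable (A : Type u) [NonUnitalCStarAlgebra A] {ι : Type w} (M : ι → Type v)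
  [∀ i, NormedAddCommGroup (M i)] [∀ i, NormedSpace ℂ (M i)] [∀ i, HilbertModule A (M i)]

/-- The inner product of two families, summed over a finite set of indices. -/
def ipFin (s : Finset ι) : (∀ i, M i) →ₗ⋆[ℂ] (∀ i, M i) →ₗ[ℂ] A :=
  LinearMap.mk₂'ₛₗ (starRingEnd ℂ) (RingHom.id ℂ)
    (fun f g => ∑ i ∈ s, HilbertModule.ip (f i) (g i))
    (by intros; simp [Finset.sum_add_distrib]) (by intros; simp [Finset.smul_sum])
    (by intros; simp [Finset.sum_add_distrib]) (by intros; simp [Finset.smul_sum])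

theorem ipFin_apply (s : Finset ι) (f g : ∀ i, M i) :
    ipFin A M s f g = ∑ i ∈ s, HilbertModule.ip (f i) (g i) := rfl

theorem isSemiInner_ipFin (s : Finset ι) :
    IsSemiInner (ipFin A M s) (fun f a i => HilbertModule.rmul (f i) a) where
  star_apply f g := by simp [ipFin_apply, HilbertModule.star_ip]
  pos f := sum_pos_form _ _ fun i => HilbertModule.ip_self_pos _
  rmul f g a := by simp [ipFin_apply, HilbertModule.ip_rmul, Finset.sum_mul]

theorem summable_ip_iff (f : ∀ i, M i) :
    Summable (fun i => HilbertModule.ip (A := A) (f i) (f i)) ↔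
      ∀ ε > 0, ∃ s : Finset ι, ∀ t, Disjoint t s → √‖ipFin A M t f f‖ < ε := by
  rw [summable_iff_vanishing_norm]
  constructor
  · intro h ε hε
    obtain ⟨s, hs⟩ := h (ε ^ 2) (by positivity)
    exact ⟨s, fun t ht => (Real.sqrt_lt' hε).2 (hs t ht)⟩
  · intro h ε hε
    obtain ⟨s, hs⟩ := h (√ε) (by positivity)
    exact ⟨s, fun t ht => (Real.sqrt_lt_sqrt_iff (norm_nonneg _)).1 (hs t ht)⟩

/-- The families `f` for which `∑ ⟨f i, f i⟩` converges (unconditionally) in `A`. -/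
def hilbertSumSubmodule : Submodule ℂ (∀ i, M i) where
  carrier := {f | Summable fun i => HilbertModule.ip (A := A) (f i) (f i)}
  zero_mem' := by simp [summable_zero]
  add_mem' := by
    intro f g hf hg
    change Summable _ at hf hg ⊢
    rw [summable_ip_iff] at *
    intro ε hε
    classical
    obtain ⟨s, hs⟩ := hf (ε / 2) (by positivity)
    obtain ⟨t, ht⟩ := hg (ε / 2) (by positivity)
    refine ⟨s ∪ t, fun r hr => ?_⟩
    rw [Finset.disjoint_union_right] at hr
    have := (isSemiInner_ipFin A M r).triangle f g
    linarith [hs r hr.1, ht r hr.2]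
  smul_mem' c f hf := by
    have : Summable fun i => (c * starRingEnd ℂ c) • HilbertModule.ip (A := A) (f i) (f i) :=
      Summable.const_smul _ hf
    simpa [mul_smul] using this

/-- The Hilbert module direct sum of the Hilbert `A`-modules `M i`. -/
def HilbertSum : Type (max v w) := hilbertSumSubmodule A M

instance : AddCommGroup (HilbertSum A M) :=
  inferInstanceAs (AddCommGroup (hilbertSumSubmodule A M))
instance : Module ℂ (HilbertSum A M) :=
  inferInstanceAs (Module ℂ (hilbertSumSubmodule A M))

namespace HilbertSum

variable {A M}

/-- The coordinates of an element of a direct sum, as a linear map. -/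
def coords : HilbertSum A M →ₗ[ℂ] ∀ i, M i := (hilbertSumSubmodule A M).subtype

/-- The element of the direct sum with given coordinates. -/
def mk (f : ∀ i, M i) (h : Summable fun i => HilbertModule.ip (A := A) (f i) (f i)) :
    HilbertSum A M := ⟨f, h⟩

@[simp] theorem coords_mk (f : ∀ i, M i)
    (h : Summable fun i => HilbertModule.ip (A := A) (f i) (f i)) : coords (mk f h) = f := rfl

theorem ext_coords {f g : HilbertSum A M} (h : ∀ i, coords f i = coords g i) : f = g :=
  Subtype.ext (funext h)

theorem summable_self (f : HilbertSum A M) :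
    Summable fun i => HilbertModule.ip (A := A) (coords f i) (coords f i) := f.2

theorem summable_ip (f g : HilbertSum A M) :
    Summable fun i => HilbertModule.ip (A := A) (coords f i) (coords g i) := by
  rw [summable_iff_vanishing_norm]
  intro ε hε
  classical
  obtain ⟨s, hs⟩ := (summable_ip_iff A M _).1 f.summable_self (√ε) (by positivity)
  obtain ⟨t, ht⟩ := (summable_ip_iff A M _).1 g.summable_self (√ε) (by positivity)
  refine ⟨s ∪ t, fun r hr => ?_⟩
  rw [Finset.disjoint_union_right] at hr
  have h1 := (isSemiInner_ipFin A M r).cs_sqrt (coords f) (coords g)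
  refine h1.trans_lt ?_
  calc _ < √ε * √ε := mul_lt_mul'' (hs r hr.1) (ht r hr.2) (Real.sqrt_nonneg _)
        (Real.sqrt_nonneg _)
    _ = ε := Real.mul_self_sqrt hε.le

/-- The inner product `∑ ⟨f i, g i⟩` of the direct sum. -/
def ipSum : HilbertSum A M →ₗ⋆[ℂ] HilbertSum A M →ₗ[ℂ] A :=
  LinearMap.mk₂'ₛₗ (starRingEnd ℂ) (RingHom.id ℂ)
    (fun f g => ∑' i, HilbertModule.ip (coords f i) (coords g i))
    (fun f f' g => by
      simp only [map_add, Pi.add_apply, LinearMap.add_apply]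
      exact (summable_ip f g).tsum_add (summable_ip f' g))
    (fun c f g => by
      simp only [map_smul, Pi.smul_apply, LinearMap.map_smulₛₗ, LinearMap.smul_apply]
      exact (summable_ip f g).tsum_const_smul _)
    (fun f g g' => by
      simp only [map_add, Pi.add_apply]
      exact (summable_ip f g).tsum_add (summable_ip f g'))
    (fun c f g => by
      simp only [map_smul, Pi.smul_apply]
      exact (summable_ip f g).tsum_const_smul _)

theorem ipSum_apply (f g : HilbertSum A M) :
    ipSum f g = ∑' i, HilbertModule.ip (A := A) (coords f i) (coords g i) := rfl

theorem tendsto_ipFin (f g : HilbertSum A M) :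
    Filter.Tendsto (fun s => ipFin A M s (coords f) (coords g)) Filter.atTop
      (nhds (ipSum f g)) := (summable_ip f g).hasSum

/-- The right multiplication of the direct sum. -/
def rmulSum : HilbertSum A M →ₗ[ℂ] A →ₗ[ℂ] HilbertSum A M :=
  LinearMap.mk₂ ℂ
    (fun f a => mk (fun i => HilbertModule.rmul (coords f i) a) (by
      have : Summable fun i => star a * HilbertModule.ip (A := A) (coords f i) (coords f i) * a :=
        (f.summable_self.mul_left _).mul_right _
      refine this.congr fun i => ?_
      rw [isSemiInner_ip.rmul_left, HilbertModule.ip_rmul, mul_assoc]))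
    (by intros; exact ext_coords fun i => by simp)
    (by intros; exact ext_coords fun i => by simp)
    (by intros; exact ext_coords fun i => by simp)
    (by intros; exact ext_coords fun i => by simp)

theorem coords_rmulSum (f : HilbertSum A M) (a : A) (i : ι) :
    coords (rmulSum f a) i = HilbertModule.rmul (coords f i) a := rfl

theorem isSemiInner_ipSum :
    IsSemiInner (ipSum (A := A) (M := M)) (fun f a => rmulSum f a) where
  star_apply f g := by
    rw [ipSum_apply, ipSum_apply, tsum_star]
    simp [HilbertModule.star_ip]
  pos f := tsum_pos_form _ fun i => HilbertModule.ip_self_pos _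
  rmul f g a := by
    rw [ipSum_apply, ipSum_apply, ← (summable_ip f g).tsum_mul_right]
    simp [coords_rmulSum, HilbertModule.ip_rmul]

theorem ipFin_le (s : Finset ι) (f : HilbertSum A M) :
    ‖ipFin A M s (coords f) (coords f)‖ ≤ ‖ipSum f f‖ := by
  have h1 := (summable_self f).sum_add_tsum_compl (s := s)
  rw [ipSum_apply, ← h1]
  exact norm_le_of_pos (sum_pos_form _ _ fun i => HilbertModule.ip_self_pos _)
    (tsum_pos_form _ fun i => HilbertModule.ip_self_pos _)

instance : Norm (HilbertSum A M) := ⟨fun f => √‖ipSum f f‖⟩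

theorem norm_def (f : HilbertSum A M) : ‖f‖ = √‖ipSum f f‖ := rfl

theorem sqrt_ipFin_le (s : Finset ι) (f : HilbertSum A M) :
    √‖ipFin A M s (coords f) (coords f)‖ ≤ ‖f‖ := Real.sqrt_le_sqrt (ipFin_le s f)

theorem norm_coords_le (f : HilbertSum A M) (i : ι) : ‖coords f i‖ ≤ ‖f‖ := by
  have := sqrt_ipFin_le {i} f
  rwa [ipFin_apply, Finset.sum_singleton, ← norm_eq_sqrt_ip] at this

theorem norm_le_of_forall (f : HilbertSum A M) (c : ℝ)
    (h : ∀ s, √‖ipFin A M s (coords f) (coords f)‖ ≤ c) : ‖f‖ ≤ c :=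
  le_of_tendsto (tendsto_ipFin f f).norm.sqrt (Filter.Eventually.of_forall h)

theorem core : NormedSpace.Core ℂ (HilbertSum A M) where
  norm_nonneg f := Real.sqrt_nonneg _
  norm_smul c f := by
    simp only [norm_def, LinearMap.map_smulₛₗ, map_smul, LinearMap.smul_apply, norm_smul,
      RCLike.norm_conj, ← mul_assoc]
    rw [Real.sqrt_mul (by positivity), Real.sqrt_mul_self (norm_nonneg _)]
  norm_triangle f g := isSemiInner_ipSum.triangle f g
  norm_eq_zero_iff f := by
    refine ⟨fun h => ext_coords fun i => ?_, fun h => by simp [h, norm_def]⟩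
    have := norm_coords_le f i
    rw [h] at this
    simpa using this

instance : NormedAddCommGroup (HilbertSum A M) := NormedAddCommGroup.ofCore core
instance : NormedSpace ℂ (HilbertSum A M) := NormedSpace.ofCore core

theorem complete : CompleteSpace (HilbertSum A M) := by
  refine Metric.complete_of_cauchySeq_tendsto fun x hx => ?_
  have hcoord : ∀ i, ∃ y, Filter.Tendsto (fun n => coords (x n) i) Filter.atTop (nhds y) := by
    intro i
    have _ : CompleteSpace (M i) := HilbertModule.complete A
    refine cauchySeq_tendsto_of_complete (Metric.cauchySeq_iff.2 fun ε hε => ?_)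
    obtain ⟨N, hN⟩ := Metric.cauchySeq_iff.1 hx ε hε
    refine ⟨N, fun m hm n hn => lt_of_le_of_lt ?_ (hN m hm n hn)⟩
    rw [dist_eq_norm, dist_eq_norm]
    simpa using norm_coords_le (x m - x n) i
  choose y hy using hcoord
  have hlim : ∀ ε > 0, ∃ N, ∀ m ≥ N, ∀ s,
      √‖ipFin A M s (y - coords (x m)) (y - coords (x m))‖ ≤ ε := by
    intro ε hε
    obtain ⟨N, hN⟩ := Metric.cauchySeq_iff.1 hx ε hε
    refine ⟨N, fun m hm s => ?_⟩
    have h1 : Filter.Tendsto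
        (fun n => √‖ipFin A M s (coords (x n) - coords (x m)) (coords (x n) - coords (x m))‖)
        Filter.atTop (nhds √‖ipFin A M s (y - coords (x m)) (y - coords (x m))‖) := by
      refine Filter.Tendsto.sqrt (Filter.Tendsto.norm ?_)
      simp only [ipFin_apply]
      refine tendsto_finsetSum _ fun i _ => ?_
      have hc : Continuous fun z : M i => ipL (A := A) (z - coords (x m) i) (z - coords (x m) i) :=
        by fun_prop
      exact (hc.tendsto (y i)).comp (hy i)
    refine le_of_tendsto h1 ?_
    filter_upwards [Filter.eventually_ge_atTop N] with n hn
    rw [← map_sub]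
    refine (sqrt_ipFin_le s _).trans ?_
    rw [← dist_eq_norm]
    exact (hN n hn m hm).le
  have hmem : Summable fun i => HilbertModule.ip (A := A) (y i) (y i) := by
    rw [summable_ip_iff]
    intro ε hε
    obtain ⟨N, hN⟩ := hlim (ε / 2) (by positivity)
    obtain ⟨s, hs⟩ := (summable_ip_iff A M _).1 (x N).summable_self (ε / 2) (by positivity)
    refine ⟨s, fun t ht => ?_⟩
    have h1 := (isSemiInner_ipFin A M t).triangle (y - coords (x N)) (coords (x N))
    rw [sub_add_cancel] at h1
    linarith [hs t ht, hN N le_rfl t]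
  refine ⟨mk y hmem, Metric.tendsto_atTop.2 fun ε hε => ?_⟩
  obtain ⟨N, hN⟩ := hlim (ε / 2) (by positivity)
  refine ⟨N, fun n hn => ?_⟩
  rw [dist_comm, dist_eq_norm]
  refine (norm_le_of_forall _ (ε / 2) fun s => ?_).trans_lt (half_lt_self hε)
  rw [map_sub, coords_mk]
  exact hN n hn s

instance : HilbertModule A (HilbertSum A M) where
  ip := ipSum
  rmul := rmulSum
  rmul_mul f a b := ext_coords fun i => by simp [coords_rmulSum, HilbertModule.rmul_mul]
  star_ip := isSemiInner_ipSum.star_apply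
  ip_self_pos := isSemiInner_ipSum.pos
  ip_rmul := isSemiInner_ipSum.rmul
  norm_sq f := by rw [norm_def, Real.sq_sqrt (norm_nonneg _)]
  complete := complete

open scoped Classical in
variable (A M) in
/-- The inclusion of the `i`th summand into the direct sum. -/
def incl (i : ι) : M i →ₗ[ℂ] HilbertSum A M where
  toFun x := mk (Pi.single i x) (summable_of_ne_finset_zero (s := {i}) fun j hj => by
    rw [Pi.single_eq_of_ne (by simpa using hj)]; simp)
  map_add' x y := ext_coords fun j => by simp [Pi.single_add]
  map_smul' c x := ext_coords fun j => by simp [Pi.single_smul]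

end HilbertSum

end sum
/-! ### Weak partial product systems and their representations -/

/-- A C⋆-correspondence from `A` to `A`: a right Hilbert `A`-module with a left action of `A` by
adjointable operators. Nondegeneracy is not required. -/
class Correspondence (A : Type u) [NonUnitalCStarAlgebra A] (E : Type v) [NormedAddCommGroup E]
    [NormedSpace ℂ E] extends HilbertModule A E where
  lmul : A →ₗ[ℂ] E →ₗ[ℂ] E
  lmul_mul : ∀ a b x, lmul (a * b) x = lmul a (lmul b x)
  ip_lmul : ∀ a x y, ip (lmul a x) y = ip x (lmul (star a) y)

open HilbertModule Correspondence

/-- A weak partial product system over `ℕ`. A linear isometry from the interior tensor product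
`H n ⊗_A H m` (the Hausdorff completion of the algebraic tensor product for the inner product
`⟨x ⊗ y, x' ⊗ y'⟩ = ⟨y, ⟨x, x'⟩ y'⟩`) to `H k` with `k = n + m` is given by a bilinear map
`mul` on `H n × H m` that preserves this inner product. The identification `unit` of `A` with
`H 0` is an isomorphism of correspondences. -/
structure WeakPartialProductSystem (A : Type u) [NonUnitalCStarAlgebra A] where
  H : ℕ → Type v
  [normed : ∀ n, NormedAddCommGroup (H n)]
  [space : ∀ n, NormedSpace ℂ (H n)]
  [corr : ∀ n, Correspondence A (H n)]
  mul : ∀ {n m k : ℕ}, n + m = k → H n →ₗ[ℂ] H m →ₗ[ℂ] H k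
  ip_mul : ∀ {n m k : ℕ} (h : n + m = k) (x x' : H n) (y y' : H m),
    ip (A := A) (mul h x y) (mul h x' y') = ip y (lmul (ip (A := A) x x') y')
  mul_lmul : ∀ {n m k : ℕ} (h : n + m = k) (a : A) (x : H n) (y : H m),
    mul h (lmul a x) y = lmul a (mul h x y)
  mul_rmul : ∀ {n m k : ℕ} (h : n + m = k) (x : H n) (y : H m) (a : A),
    mul h x (rmul y a) = rmul (mul h x y) a
  assoc : ∀ {n m l nm ml k : ℕ} (h₁ : n + m = nm) (h₂ : nm + l = k) (h₃ : m + l = ml)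
    (h₄ : n + ml = k) (x : H n) (y : H m) (z : H l),
    mul h₂ (mul h₁ x y) z = mul h₄ x (mul h₃ y z)
  unit : A ≃ₗ[ℂ] H 0
  ip_unit : ∀ a b, ip (A := A) (unit a) (unit b) = star a * b
  lmul_unit : ∀ a b, lmul a (unit b) = unit (a * b)
  rmul_unit : ∀ a b, rmul (unit a) b = unit (a * b)
  unit_mul : ∀ {m : ℕ} (h : 0 + m = m) (a : A) (x : H m), mul h (unit a) x = lmul a x
  mul_unit : ∀ {m : ℕ} (h : m + 0 = m) (x : H m) (a : A), mul h x (unit a) = rmul x a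

attribute [instance] WeakPartialProductSystem.normed WeakPartialProductSystem.space
  WeakPartialProductSystem.corr

/-- The closed linear span of the products `x * y` with `x ∈ X`, `y ∈ Y`. -/
def closedProd {B : Type w} [NonUnitalCStarAlgebra B] (X Y : Set B) : Submodule ℂ B :=
  (Submodule.span ℂ (Set.image2 (fun x y => x * y) X Y)).topologicalClosure

namespace WeakPartialProductSystem

variable {A : Type u} [NonUnitalCStarAlgebra A] (W : WeakPartialProductSystem.{u, v} A)

/-- Weak representations of a weak partial product system in a C⋆-algebra. -/
structure IsWeakRepresentation {B : Type w} [NonUnitalCStarAlgebra B]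
    (ω : ∀ n, W.H n →ₗ[ℂ] B) : Prop where
  mul : ∀ {n m k : ℕ} (h : n + m = k) (x : W.H n) (y : W.H m),
    ω n x * ω m y = ω k (W.mul h x y)
  star_mul : ∀ (n : ℕ) (x y : W.H n), star (ω n x) * ω n y = ω 0 (W.unit (ip x y))

/-- Representations of a weak partial product system in a C⋆-algebra. -/
structure IsRepresentation {B : Type w} [NonUnitalCStarAlgebra B]
    (ω : ∀ n, W.H n →ₗ[ℂ] B) : Prop extends W.IsWeakRepresentation ω where
  lt : ∀ n m : ℕ, 0 < n → n < m →
    closedProd (star (Set.range (ω n))) (Set.range (ω m)) ≤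
      closedProd (Set.range (ω (m - n))) Set.univ
  gt : ∀ n m : ℕ, 0 < m → m < n →
    closedProd (star (Set.range (ω n))) (Set.range (ω m)) ≤
      closedProd (star (Set.range (ω (n - m)))) Set.univ

/-- The Fock module, the Hilbert module direct sum of all `H n`. -/
abbrev Fock : Type v := HilbertSum A W.H

/-- `S` is the Fock representation: `S n x` is the (necessarily unique) adjointable operator on the
Fock module that maps `y` in the summand `H m` to `x · y` in the summand `H (n + m)`. -/
def IsFockRepresentation (S : ∀ n, W.H n →ₗ[ℂ] Adjointable A W.Fock) : Prop :=
  ∀ (n m : ℕ) (x : W.H n) (y : W.H m),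
    (S n x : W.Fock →L[ℂ] W.Fock) (HilbertSum.incl A W.H m y) =
      HilbertSum.incl A W.H (n + m) (W.mul rfl x y)

/-- A partial product system is a weak partial product system for which the Fock representation
exists (that is, the creation operators are adjointable) and is a representation. -/
def IsPartialProductSystem : Prop :=
  ∃ S : ∀ n, W.H n →ₗ[ℂ] Adjointable A W.Fock, W.IsFockRepresentation S ∧ W.IsRepresentation S

end WeakPartialProductSystem
/-! ### The Hilbert module and the correspondence of a graph -/

section graph

variable {V : Type u} {E : Type v}

/-- The Hilbert space `ℓ²(s⁻¹(v))` over a vertex `v`. -/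
abbrev Fib (s : E → V) (v : V) : Type v := lp (fun _ : {e // s e = v} => ℂ) 2

/-- The completion of the space of finitely supported functions on `E` for the `C₀(V)`-valued inner
product `⟨x, y⟩(v) = ∑ conj (x e) * y e`, with the sum over `e ∈ s⁻¹(v)`. It is the `c₀`-direct
sum of the Hilbert spaces `ℓ²(s⁻¹(v))`. -/
def GraphModule (s : E → V) : Submodule ℂ (lp (fun v : V => Fib s v) ⊤) where
  carrier := {x | Filter.Tendsto (fun v => ‖x v‖) Filter.cofinite (nhds 0)}
  zero_mem' := by simpa using tendsto_const_nhds
  add_mem' {x y} hx hy := by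
    refine squeeze_zero (fun _ => norm_nonneg _) (fun v => norm_add_le (x v) (y v)) ?_
    simpa using Filter.Tendsto.add hx hy
  smul_mem' c x hx := by
    refine (squeeze_zero (fun _ => norm_nonneg _) (fun v => (norm_smul c (x v)).le) ?_)
    simpa using Filter.Tendsto.const_mul ‖c‖ hx

/-- The functions on the edge set that represent elements of `GraphModule s`. -/
def IsGraphVec (s : E → V) (f : E → ℂ) : Prop :=
  (∀ v, Summable fun e : {e // s e = v} => ‖f e‖ ^ 2) ∧
    Filter.Tendsto (fun v => ∑' e : {e // s e = v}, ‖f e‖ ^ 2) Filter.cofinite (nhds 0)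

namespace GraphModule

variable {s : E → V}

/-- The values of an element of `GraphModule s` on the edges. -/
def val : GraphModule s →ₗ[ℂ] E → ℂ where
  toFun x e := x.1 (s e) ⟨e, rfl⟩
  map_add' _ _ := rfl
  map_smul' _ _ := rfl

theorem val_fib (x : GraphModule s) (v : V) (e : {e // s e = v}) : val x e = x.1 v e := by
  obtain ⟨e, rfl⟩ := e
  rfl

theorem val_ext {x y : GraphModule s} (h : ∀ e, val x e = val y e) : x = y := by
  refine Subtype.ext (lp.ext (funext fun v => lp.ext (funext fun e => ?_)))
  rw [← val_fib, ← val_fib, h]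

theorem hasSum_sq (x : GraphModule s) (v : V) :
    HasSum (fun e : {e // s e = v} => ‖val x e‖ ^ 2) (‖x.1 v‖ ^ 2) := by
  have := lp.hasSum_norm (p := 2) (by norm_num) (x.1 v)
  simpa [val_fib] using this

theorem isGraphVec (x : GraphModule s) : IsGraphVec s (val x) := by
  refine ⟨fun v => (hasSum_sq x v).summable, ?_⟩
  simp only [(hasSum_sq x _).tsum_eq]
  simpa using Filter.Tendsto.pow x.2 2

/-- The element of `GraphModule s` with given values. -/
def mk (f : E → ℂ) (h : IsGraphVec s f) : GraphModule s :=
  let y : ∀ v, Fib s v := fun v => ⟨fun e => f e, memℓp_gen (by simpa using h.1 v)⟩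
  have hy : ∀ v, ‖y v‖ = √(∑' e : {e // s e = v}, ‖f e‖ ^ 2) := fun v => by
    have := lp.norm_rpow_eq_tsum (p := 2) (by norm_num) (y v)
    simp only [ENNReal.toReal_ofNat, Real.rpow_ofNat] at this
    rw [← this, Real.sqrt_sq (norm_nonneg _)]
  have ht : Filter.Tendsto (fun v => ‖y v‖) Filter.cofinite (nhds 0) := by
    simp only [hy]
    simpa using h.2.sqrt
  ⟨⟨y, memℓp_infty (by
    have h1 : {v | ¬ ‖y v‖ < 1}.Finite := ht.eventually (gt_mem_nhds one_pos)
    refine ((h1.image fun v => ‖y v‖).bddAbove.union (bddAbove_Iic (a := (1 : ℝ)))).mono ?_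
    rintro _ ⟨v, rfl⟩
    by_cases hv : ‖y v‖ < 1
    · exact Or.inr hv.le
    · exact Or.inl ⟨v, hv, rfl⟩)⟩, ht⟩

@[simp] theorem val_mk (f : E → ℂ) (h : IsGraphVec s f) : val (mk f h) = f := rfl

end GraphModule

/-- Bounded multiples of elements of `GraphModule s` are again such. -/
theorem IsGraphVec.of_le {s : E → V} {f g : E → ℂ} (hf : IsGraphVec s f) (c : ℝ)
    (h : ∀ e, ‖g e‖ ≤ c * ‖f e‖) : IsGraphVec s g := by
  have h1 : ∀ e, ‖g e‖ ^ 2 ≤ c ^ 2 * ‖f e‖ ^ 2 := fun e => by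
    rw [← mul_pow]; exact pow_le_pow_left₀ (norm_nonneg _) (h e) 2
  have hs : ∀ v, Summable fun e : {e // s e = v} => ‖g e‖ ^ 2 := fun v =>
    Summable.of_nonneg_of_le (fun _ => by positivity) (fun e => h1 e) ((hf.1 v).mul_left _)
  refine ⟨hs, squeeze_zero (fun _ => tsum_nonneg fun _ => by positivity) (fun v => ?_)
    (by simpa using hf.2.const_mul (c ^ 2))⟩
  rw [← tsum_mul_left]
  exact (hs v).tsum_le_tsum (fun e => h1 e) ((hf.1 v).mul_left _)

variable [TopologicalSpace V] [DiscreteTopology V]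

/-- A function on a discrete space that tends to zero along finite sets, as an element of `C₀`. -/
def mkC0 (f : V → ℂ) (h : Filter.Tendsto f Filter.cofinite (nhds 0)) : C₀(V, ℂ) where
  toFun := f
  continuous_toFun := continuous_of_discreteTopology
  zero_at_infty' := by rwa [Filter.cocompact_eq_cofinite]

@[simp] theorem mkC0_apply (f : V → ℂ) (h : Filter.Tendsto f Filter.cofinite (nhds 0)) (v : V) :
    mkC0 f h v = f v := rfl

theorem tendsto_C0 (a : C₀(V, ℂ)) : Filter.Tendsto a Filter.cofinite (nhds 0) := by
  rw [← Filter.cocompact_eq_cofinite]; exact a.zero_at_infty'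

theorem norm_C0_apply_le (a : C₀(V, ℂ)) (v : V) : ‖a v‖ ≤ ‖a‖ :=
  a.toBCF.norm_coe_le_norm v

theorem norm_C0_le (a : C₀(V, ℂ)) {c : ℝ} (hc : 0 ≤ c) (h : ∀ v, ‖a v‖ ≤ c) : ‖a‖ ≤ c :=
  (BoundedContinuousFunction.norm_le hc).2 h

namespace GraphModule

variable {s : E → V}

theorem norm_apply_le (x : GraphModule s) (v : V) : ‖x.1 v‖ ≤ ‖x‖ :=
  lp.norm_apply_le_norm (by simp) x.1 v

/-- The `C₀(V)`-valued inner product. -/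
def ipG : GraphModule s →ₗ⋆[ℂ] GraphModule s →ₗ[ℂ] C₀(V, ℂ) :=
  LinearMap.mk₂'ₛₗ (starRingEnd ℂ) (RingHom.id ℂ)
    (fun x y => mkC0 (fun v => ∑' e : {e // s e = v}, starRingEnd ℂ (val x e) * val y e) (by
      have h : ∀ v, ‖∑' e : {e // s e = v}, starRingEnd ℂ (val x e) * val y e‖
          ≤ ‖x.1 v‖ * ‖y.1 v‖ := fun v => by
        have := norm_inner_le_norm (𝕜 := ℂ) (x.1 v) (y.1 v)
        rw [lp.inner_eq_tsum] at this
        simpa [val_fib, mul_comm] using this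
      refine squeeze_zero_norm h ?_
      simpa using Filter.Tendsto.mul x.2 y.2))
    (fun x x' y => by
      ext v
      have h := inner_add_left (𝕜 := ℂ) (x.1 v) (x'.1 v) (y.1 v)
      simp only [lp.inner_eq_tsum] at h
      simpa [val_fib, mul_comm] using h)
    (fun c x y => by
      ext v
      have h := inner_smul_left (𝕜 := ℂ) (x.1 v) (y.1 v) c
      simp only [lp.inner_eq_tsum] at h
      simpa [val_fib, mul_comm] using h)
    (fun x y y' => by
      ext v
      have h := inner_add_right (𝕜 := ℂ) (x.1 v) (y.1 v) (y'.1 v)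
      simp only [lp.inner_eq_tsum] at h
      simpa [val_fib, mul_comm] using h)
    (fun c x y => by
      ext v
      have h := inner_smul_right (𝕜 := ℂ) (x.1 v) (y.1 v) c
      simp only [lp.inner_eq_tsum] at h
      simpa [val_fib, mul_comm] using h)

theorem ipG_apply (x y : GraphModule s) (v : V) :
    ipG x y v = ∑' e : {e // s e = v}, starRingEnd ℂ (val x e) * val y e := rfl

theorem ipG_eq_inner (x y : GraphModule s) (v : V) : ipG x y v = inner ℂ (x.1 v) (y.1 v) := by
  rw [lp.inner_eq_tsum, ipG_apply]
  simp [val_fib, mul_comm]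

theorem summable_ip (x y : GraphModule s) (v : V) :
    Summable fun e : {e // s e = v} => starRingEnd ℂ (val x e) * val y e := by
  have := lp.summable_inner (𝕜 := ℂ) (x.1 v) (y.1 v)
  simpa [val_fib, mul_comm] using this

/-- The right multiplication `(x · a)(e) = x(e) a(s(e))`. -/
def rmulG : GraphModule s →ₗ[ℂ] C₀(V, ℂ) →ₗ[ℂ] GraphModule s :=
  LinearMap.mk₂ ℂ
    (fun x a => mk (fun e => val x e * a (s e)) ((isGraphVec x).of_le ‖a‖ fun e => by
      rw [norm_mul, mul_comm]; gcongr; exact norm_C0_apply_le _ _))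
    (by intros; exact val_ext fun e => by simp [add_mul])
    (by intros; exact val_ext fun e => by simp [mul_assoc])
    (by intros; exact val_ext fun e => by simp [mul_add])
    (by intros; exact val_ext fun e => by simp [mul_left_comm])

@[simp] theorem val_rmulG (x : GraphModule s) (a : C₀(V, ℂ)) (e : E) :
    val (rmulG x a) e = val x e * a (s e) := rfl

/-- The left multiplication `(a · x)(e) = a(r(e)) x(e)`. -/
def lmulG (r : E → V) : C₀(V, ℂ) →ₗ[ℂ] GraphModule s →ₗ[ℂ] GraphModule s :=
  LinearMap.mk₂ ℂ
    (fun a x => mk (fun e => a (r e) * val x e) ((isGraphVec x).of_le ‖a‖ fun e => by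
      rw [norm_mul]; gcongr; exact norm_C0_apply_le _ _))
    (by intros; exact val_ext fun e => by simp [add_mul])
    (by intros; exact val_ext fun e => by simp [mul_assoc])
    (by intros; exact val_ext fun e => by simp [mul_add])
    (by intros; exact val_ext fun e => by simp [mul_left_comm])

@[simp] theorem val_lmulG (r : E → V) (a : C₀(V, ℂ)) (x : GraphModule s) (e : E) :
    val (lmulG r a x) e = a (r e) * val x e := rfl

theorem complete : CompleteSpace (GraphModule s) := by
  refine IsComplete.completeSpace_coe (s := (GraphModule s : Set (lp (fun v => Fib s v) ⊤)))
    (IsClosed.isComplete ?_)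
  rw [← isSeqClosed_iff_isClosed]
  intro x y hx hlim
  refine Metric.tendsto_nhds.2 fun ε hε => ?_
  obtain ⟨N, hN⟩ := Metric.tendsto_atTop.1 hlim (ε / 2) (by positivity)
  filter_upwards [Metric.tendsto_nhds.1 (hx N) (ε / 2) (by positivity)] with v hv
  have h1 := hN N le_rfl
  rw [dist_comm, dist_eq_norm] at h1
  have h2 := lp.norm_apply_le_norm (by simp) (y - x N) v
  simp only [dist_zero_right, norm_norm] at hv ⊢
  have h3 : ‖y v‖ ≤ ‖(y - x N) v‖ + ‖x N v‖ := by
    simpa using norm_add_le ((y - x N) v) (x N v)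
  linarith

theorem norm_sq_eq (x : GraphModule s) : ‖x‖ ^ 2 = ‖ipG x x‖ := by
  have h : ∀ v, ‖ipG x x v‖ = ‖x.1 v‖ ^ 2 := fun v => by
    rw [ipG_eq_inner, inner_self_eq_norm_sq_to_K]; simp
  refine le_antisymm ?_ (norm_C0_le _ (by positivity) fun v => ?_)
  · rw [← Real.le_sqrt (norm_nonneg _) (norm_nonneg _)]
    refine lp.norm_le_of_forall_le (Real.sqrt_nonneg _) fun v => Real.le_sqrt_of_sq_le ?_
    refine (h v).symm.le.trans ?_
    exact norm_C0_apply_le _ _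
  · rw [h]
    gcongr
    exact norm_apply_le x v

instance : HilbertModule C₀(V, ℂ) (GraphModule s) where
  ip := ipG
  rmul := rmulG
  rmul_mul x a b := val_ext fun e => by simp [mul_assoc]
  star_ip x y := by
    ext v
    simp only [ZeroAtInftyContinuousMap.star_apply, ipG_eq_inner]
    exact inner_conj_symm _ _
  ip_self_pos x := by
    refine ⟨mkC0 (fun v => (‖x.1 v‖ : ℂ)) ?_, ?_⟩
    · have := (Complex.continuous_ofReal.tendsto 0).comp x.2
      simpa [Function.comp_def] using this
    · ext v
      simp [ipG_eq_inner, inner_self_eq_norm_sq_to_K, pow_two]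
  ip_rmul x y a := by
    ext v
    simp only [ipG_apply, ZeroAtInftyContinuousMap.mul_apply, ← tsum_mul_right]
    refine tsum_congr fun e => ?_
    simp [e.2, mul_assoc]
  norm_sq := norm_sq_eq
  complete := complete

open scoped Classical in
/-- The characteristic function of an edge. -/
def delta (s : E → V) (e : E) : GraphModule s :=
  GraphModule.mk (Pi.single e 1) (by
    refine ⟨fun v => summable_of_ne_finset_zero (s := (Set.finite_singleton e).preimage
      (Subtype.val_injective (p := fun e' => s e' = v)).injOn |>.toFinset) fun e' he' => ?_, ?_⟩
    · simp only [Set.Finite.mem_toFinset, Set.mem_preimage, Set.mem_singleton_iff] at he'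
      simp [Pi.single_eq_of_ne he']
    · refine tendsto_const_nhds.congr' ?_
      have h : ∀ᶠ v in Filter.cofinite, v ≠ s e := by
        simp [Filter.eventually_cofinite]
      filter_upwards [h] with v hv
      symm
      convert tsum_zero with e'
      have : (e' : E) ≠ e := fun h => hv (by rw [← e'.2, h])
      simp [Pi.single_eq_of_ne this])

open scoped Classical in
theorem val_delta (e e' : E) : val (delta s e) e' = if e' = e then 1 else 0 := by
  change (Pi.single e (1 : ℂ) : E → ℂ) e' = _
  rw [Pi.single_apply]

open scoped Classical in
/-- `⟨δ_e, δ_e'⟩` is the characteristic function of `s e` if `e = e'`, and `0` otherwise. -/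
theorem ipG_delta (e e' : E) (v : V) :
    ipG (delta s e) (delta s e') v = if e = e' ∧ s e = v then 1 else 0 := by
  rw [ipG_apply]
  by_cases hv : s e = v
  · rw [tsum_eq_single ⟨e, hv⟩ fun e'' he'' => by
      have : (e'' : E) ≠ e := fun h => he'' (Subtype.ext h)
      simp [val_delta, this]]
    simp [val_delta, hv]
  · convert tsum_zero with e''
    · have : (e'' : E) ≠ e := fun h => hv (by rw [← h, e''.2])
      simp [val_delta, this]
    · simp [hv]

/-- The finitely supported functions are dense in `GraphModule s`. -/
theorem dense_span_delta :
    (Submodule.span ℂ (Set.range (delta s))).topologicalClosure = ⊤ := by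
  classical
  set D := (Submodule.span ℂ (Set.range (delta s))).topologicalClosure
  have hD : IsClosed (D : Set (GraphModule s)) := Submodule.isClosed_topologicalClosure _
  have hsub : ∀ (x y : GraphModule s) (c : ℝ), 0 ≤ c → (∀ v, ‖x.1 v - y.1 v‖ ≤ c) →
      ‖x - y‖ ≤ c := fun x y c hc h => lp.norm_le_of_forall_le hc h
  -- restrictions to finite sets of edges
  have hfin : ∀ (x : GraphModule s) (T : Finset E), ∃ y ∈ D, ∀ e,
      val y e = if e ∈ T then val x e else 0 := fun x T => by
    refine ⟨∑ e ∈ T, val x e • delta s e, sum_mem fun e _ => D.smul_mem _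
      (Submodule.le_topologicalClosure _ (Submodule.subset_span ⟨e, rfl⟩)), fun e => ?_⟩
    simp [val_delta, Finset.sum_apply]
  refine (Submodule.eq_top_iff').2 fun x => ?_
  have hcl : x ∈ closure (D : Set (GraphModule s)) := by
    refine Metric.mem_closure_iff.2 fun ε hε => ?_
    have hT : {v | ¬ ‖x.1 v‖ < ε / 2}.Finite :=
      Filter.Tendsto.eventually x.2 (gt_mem_nhds (by positivity))
    have hv : ∀ v, ∃ T : Finset {e // s e = v}, ∀ T', T ⊆ T' →
        ∑ e ∈ T', ‖val x e‖ ^ 2 > ‖x.1 v‖ ^ 2 - (ε / 2) ^ 2 := fun v => by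
      have := (hasSum_sq x v).eventually (lt_mem_nhds (sub_lt_self _ (by positivity :
        (0 : ℝ) < (ε / 2) ^ 2)))
      exact Filter.eventually_atTop.1 this
    choose T hT' using hv
    obtain ⟨y, hyD, hy⟩ := hfin x (hT.toFinset.biUnion fun v => (T v).map (.subtype _))
    refine ⟨y, hyD, ?_⟩
    rw [dist_eq_norm]
    refine lt_of_le_of_lt (hsub x y (ε / 2) (by positivity) fun v => ?_) (half_lt_self hε)
    have hval : ∀ e : {e // s e = v}, val (x - y) e =
        if ¬ ‖x.1 v‖ < ε / 2 ∧ e ∈ T v then 0 else val x e := by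
      rintro ⟨e, rfl⟩
      rw [map_sub, Pi.sub_apply, hy]
      have : e ∈ (hT.toFinset.biUnion fun v => (T v).map (.subtype _)) ↔
          ¬ ‖x.1 (s e)‖ < ε / 2 ∧ (⟨e, rfl⟩ : {e' // s e' = s e}) ∈ T (s e) := by
        simp only [Finset.mem_biUnion, Set.Finite.mem_toFinset, Set.mem_ofPred_eq,
          Finset.mem_map, Function.Embedding.subtype_apply]
        constructor
        · rintro ⟨v, hv, ⟨e', rfl⟩, he', rfl⟩
          exact ⟨hv, he'⟩
        · rintro ⟨h1, h2⟩
          exact ⟨_, h1, _, h2, rfl⟩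
      simp only [this]
      split_ifs <;> simp
    change ‖(x - y).1 v‖ ≤ ε / 2
    have hs := hasSum_sq (x - y) v
    by_cases hxv : ‖x.1 v‖ < ε / 2
    · have h0 : HasSum (fun e : {e // s e = v} => ‖val (x - y) e‖ ^ 2) (‖x.1 v‖ ^ 2) := by
        refine (hasSum_sq x v).congr_fun ?_
        intro e
        rw [hval]
        simp [hxv]
      have := hs.unique h0
      rw [sq_eq_sq₀ (norm_nonneg _) (norm_nonneg _)] at this
      rw [this]
      exact hxv.le
    · have h1 : HasSum (fun e : {e // s e = v} => ‖val x e‖ ^ 2 - ‖val (x - y) e‖ ^ 2)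
          (‖x.1 v‖ ^ 2 - ‖(x - y).1 v‖ ^ 2) := (hasSum_sq x v).sub hs
      have h2 : HasSum (fun e : {e // s e = v} => ‖val x e‖ ^ 2 - ‖val (x - y) e‖ ^ 2)
          (∑ e ∈ T v, ‖val x e‖ ^ 2) := by
        have : ∑ e ∈ T v, ‖val x e‖ ^ 2 =
            ∑ e ∈ T v, (‖val x e‖ ^ 2 - ‖val (x - y) e‖ ^ 2) :=
          Finset.sum_congr rfl fun e he => by rw [hval]; simp [hxv, he]
        rw [this]
        refine hasSum_sum_of_ne_finset_zero fun e he => ?_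
        rw [hval]
        simp [he]
      have h3 := h1.unique h2
      have h4 := hT' v (T v) subset_rfl
      have h5 : ‖(x - y).1 v‖ ^ 2 ≤ (ε / 2) ^ 2 := by linarith
      exact (pow_le_pow_iff_left₀ (norm_nonneg _) (by positivity) two_ne_zero).1 h5
  rwa [hD.closure_eq] at hcl

/-- The correspondence of a graph with range map `r` and source map `s`. -/
abbrev corr (r : E → V) : Correspondence C₀(V, ℂ) (GraphModule s) where
  lmul := lmulG r
  lmul_mul a b x := val_ext fun e => by simp [mul_assoc]
  ip_lmul a x y := by
    ext v
    change ipG _ _ v = ipG _ _ v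
    simp only [ipG_apply]
    refine tsum_congr fun e => ?_
    simp [mul_left_comm, mul_assoc]

end GraphModule

end graph
/-! ### Multiplication on graph correspondences -/

section mul

variable {V : Type u} {E₁ E₂ E₃ : Type v} {s₁ : E₁ → V} {r₂ s₂ : E₂ → V} {s₃ : E₃ → V}
  {m : {p : E₁ × E₂ // s₁ p.1 = r₂ p.2} → E₃}

/-- The function `f * g` with `(f * g)(x · y) = f x * g y`, and `0` at edges that are not products
`x · y = m (x, y)`. -/
def mulVal (m : {p : E₁ × E₂ // s₁ p.1 = r₂ p.2} → E₃) (f : E₁ → ℂ) (g : E₂ → ℂ) : E₃ → ℂ :=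
  Function.extend m (fun p => f p.1.1 * g p.1.2) 0

theorem mulVal_apply (hm : Function.Injective m) (f : E₁ → ℂ) (g : E₂ → ℂ)
    (p : {p : E₁ × E₂ // s₁ p.1 = r₂ p.2}) : mulVal m f g (m p) = f p.1.1 * g p.1.2 :=
  hm.extend_apply _ _ _

theorem mulVal_apply' (f : E₁ → ℂ) (g : E₂ → ℂ) (z : E₃) (hz : z ∉ Set.range m) :
    mulVal m f g z = 0 := Function.extend_apply' _ _ _ hz

theorem mulVal_add_left (hm : Function.Injective m) (f f' : E₁ → ℂ) (g : E₂ → ℂ) (z : E₃) :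
    mulVal m (f + f') g z = mulVal m f g z + mulVal m f' g z := by
  by_cases hz : z ∈ Set.range m
  · obtain ⟨p, rfl⟩ := hz
    simp only [mulVal_apply hm, Pi.add_apply]
    ring
  · simp [mulVal_apply' _ _ z hz]

theorem mulVal_smul_left (hm : Function.Injective m) (c : ℂ) (f : E₁ → ℂ) (g : E₂ → ℂ) (z : E₃) :
    mulVal m (c • f) g z = c • mulVal m f g z := by
  by_cases hz : z ∈ Set.range m
  · obtain ⟨p, rfl⟩ := hz
    simp only [mulVal_apply hm, Pi.smul_apply, smul_eq_mul]
    ring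
  · simp [mulVal_apply' _ _ z hz]

theorem mulVal_add_right (hm : Function.Injective m) (f : E₁ → ℂ) (g g' : E₂ → ℂ) (z : E₃) :
    mulVal m f (g + g') z = mulVal m f g z + mulVal m f g' z := by
  by_cases hz : z ∈ Set.range m
  · obtain ⟨p, rfl⟩ := hz
    simp only [mulVal_apply hm, Pi.add_apply]
    ring
  · simp [mulVal_apply' _ _ z hz]

theorem mulVal_smul_right (hm : Function.Injective m) (c : ℂ) (f : E₁ → ℂ) (g : E₂ → ℂ) (z : E₃) :
    mulVal m f (c • g) z = c • mulVal m f g z := by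
  by_cases hz : z ∈ Set.range m
  · obtain ⟨p, rfl⟩ := hz
    simp only [mulVal_apply hm, Pi.smul_apply, smul_eq_mul]
    ring
  · simp [mulVal_apply' _ _ z hz]

theorem hasSum_fib_iff {M : Type} [AddCommMonoid M] [TopologicalSpace M]
    (hm : Function.Injective m) (hs : ∀ p, s₃ (m p) = s₂ p.1.2) (F : E₃ → M)
    (hF : ∀ z, z ∉ Set.range m → F z = 0) (v : V) (a : M) :
    HasSum (fun q : Σ y : {y // s₂ y = v}, {x // s₁ x = r₂ y} =>
      F (m ⟨(q.2.1, q.1.1), q.2.2⟩)) a ↔ HasSum (fun z : {z // s₃ z = v} => F z) a := by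
  let j : (Σ y : {y // s₂ y = v}, {x // s₁ x = r₂ y}) → {z // s₃ z = v} :=
    fun q => ⟨m ⟨(q.2.1, q.1.1), q.2.2⟩, (hs _).trans q.1.2⟩
  have hj : Function.Injective j := by
    rintro ⟨⟨y, hy⟩, ⟨x, hx⟩⟩ ⟨⟨y', hy'⟩, ⟨x', hx'⟩⟩ h
    have h1 := hm (congrArg Subtype.val h)
    simp only [Subtype.mk.injEq, Prod.mk.injEq] at h1
    obtain ⟨rfl, rfl⟩ := h1
    rfl
  refine hj.hasSum_iff (f := fun z : {z // s₃ z = v} => F z) ?_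
  rintro ⟨z, hz⟩ hzr
  refine hF z fun ⟨p, hp⟩ => hzr ⟨⟨⟨p.1.2, ?_⟩, ⟨p.1.1, p.2⟩⟩, Subtype.ext hp⟩
  rw [← hs, hp, hz]

variable [TopologicalSpace V] [DiscreteTopology V]

open GraphModule

theorem isGraphVec_mulVal (hm : Function.Injective m) (hs : ∀ p, s₃ (m p) = s₂ p.1.2)
    (f : GraphModule s₁) (g : GraphModule s₂) : IsGraphVec s₃ (mulVal m (val f) (val g)) := by
  have key : ∀ v, ∃ a, a ≤ ‖f‖ ^ 2 * ∑' y : {y // s₂ y = v}, ‖val g y‖ ^ 2 ∧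
      HasSum (fun z : {z // s₃ z = v} => ‖mulVal m (val f) (val g) z‖ ^ 2) a := by
    intro v
    have h1 : ∀ y : {y // s₂ y = v}, HasSum (fun x : {x // s₁ x = r₂ y} =>
        ‖mulVal m (val f) (val g) (m ⟨(x.1, y.1), x.2⟩)‖ ^ 2)
        (‖f.1 (r₂ y)‖ ^ 2 * ‖val g y‖ ^ 2) := fun y => by
      simp only [mulVal_apply hm, norm_mul, mul_pow]
      exact (hasSum_sq f (r₂ y)).mul_right _
    have hle : ∀ y : {y // s₂ y = v},
        ‖f.1 (r₂ y)‖ ^ 2 * ‖val g y‖ ^ 2 ≤ ‖f‖ ^ 2 * ‖val g y‖ ^ 2 := fun y => by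
      gcongr
      exact norm_apply_le f _
    have h2 : Summable fun y : {y // s₂ y = v} => ‖f.1 (r₂ y)‖ ^ 2 * ‖val g y‖ ^ 2 :=
      Summable.of_nonneg_of_le (fun _ => by positivity) hle
        ((hasSum_sq g v).summable.mul_left _)
    have h3 : Summable fun q : Σ y : {y // s₂ y = v}, {x // s₁ x = r₂ y} =>
        ‖mulVal m (val f) (val g) (m ⟨(q.2.1, q.1.1), q.2.2⟩)‖ ^ 2 := by
      refine (summable_sigma_of_nonneg fun _ => by positivity).2
        ⟨fun y => (h1 y).summable, ?_⟩
      simpa only [(h1 _).tsum_eq] using h2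
    refine ⟨_, ?_, (hasSum_fib_iff hm hs (fun z => ‖mulVal m (val f) (val g) z‖ ^ 2)
      (fun z hz => by simp [mulVal_apply' _ _ z hz]) v _).1 h3.hasSum⟩
    rw [h3.tsum_sigma]
    simp only [(h1 _).tsum_eq]
    rw [← tsum_mul_left]
    exact h2.tsum_le_tsum hle ((hasSum_sq g v).summable.mul_left _)
  refine ⟨fun v => (key v).choose_spec.2.summable,
    squeeze_zero (fun _ => tsum_nonneg fun _ => by positivity) (fun v => ?_)
      (by simpa using (isGraphVec g).2.const_mul (‖f‖ ^ 2))⟩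
  obtain ⟨a, ha, h⟩ := key v
  rw [h.tsum_eq]
  exact ha

/-- The multiplication of graph correspondences, with `δ_x * δ_y = δ_{x · y}` if `x`, `y` are
composable and `0` otherwise. -/
def mulG (hm : Function.Injective m) (hs : ∀ p, s₃ (m p) = s₂ p.1.2) :
    GraphModule s₁ →ₗ[ℂ] GraphModule s₂ →ₗ[ℂ] GraphModule s₃ :=
  LinearMap.mk₂ ℂ (fun f g => GraphModule.mk (mulVal m (val f) (val g))
      (isGraphVec_mulVal hm hs f g))
    (fun f f' g => val_ext fun z => mulVal_add_left hm (val f) (val f') (val g) z)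
    (fun c f g => val_ext fun z => mulVal_smul_left hm c (val f) (val g) z)
    (fun f g g' => val_ext fun z => mulVal_add_right hm (val f) (val g) (val g') z)
    (fun c f g => val_ext fun z => mulVal_smul_right hm c (val f) (val g) z)

theorem val_mulG (hm : Function.Injective m) (hs : ∀ p, s₃ (m p) = s₂ p.1.2)
    (f : GraphModule s₁) (g : GraphModule s₂) :
    val (mulG hm hs f g) = mulVal m (val f) (val g) := rfl

theorem ip_mulG (hm : Function.Injective m) (hs : ∀ p, s₃ (m p) = s₂ p.1.2)
    (f f' : GraphModule s₁) (g g' : GraphModule s₂) :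
    ipG (mulG hm hs f g) (mulG hm hs f' g') = ipG g (lmulG r₂ (ipG f f') g') := by
  ext v
  have h1 := (summable_ip (mulG hm hs f g) (mulG hm hs f' g') v).hasSum
  rw [← hasSum_fib_iff hm hs (fun z => starRingEnd ℂ (val (mulG hm hs f g) z) *
    val (mulG hm hs f' g') z) (fun z hz => by simp [val_mulG, mulVal_apply' _ _ z hz])] at h1
  rw [ipG_apply, ← h1.tsum_eq, h1.summable.tsum_sigma, ipG_apply]
  refine tsum_congr fun y => ?_
  simp only [val_mulG, mulVal_apply hm, val_lmulG]
  rw [ipG_apply, ← tsum_mul_right, ← tsum_mul_left]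
  refine tsum_congr fun x => ?_
  simp only [map_mul]
  ring

theorem mulG_lmulG (hm : Function.Injective m) (hs : ∀ p, s₃ (m p) = s₂ p.1.2)
    {r₁ : E₁ → V} {r₃ : E₃ → V} (hr : ∀ p, r₃ (m p) = r₁ p.1.1) (a : C₀(V, ℂ))
    (f : GraphModule s₁) (g : GraphModule s₂) :
    mulG hm hs (lmulG r₁ a f) g = lmulG r₃ a (mulG hm hs f g) := val_ext fun z => by
  simp only [val_mulG, val_lmulG]
  by_cases hz : z ∈ Set.range m
  · obtain ⟨p, rfl⟩ := hz
    simp [mulVal_apply hm, mul_assoc, hr]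
  · simp [mulVal_apply' _ _ z hz]

theorem mulG_rmulG (hm : Function.Injective m) (hs : ∀ p, s₃ (m p) = s₂ p.1.2)
    (f : GraphModule s₁) (g : GraphModule s₂) (a : C₀(V, ℂ)) :
    mulG hm hs f (rmulG g a) = rmulG (mulG hm hs f g) a := val_ext fun z => by
  simp only [val_mulG, val_rmulG]
  by_cases hz : z ∈ Set.range m
  · obtain ⟨p, rfl⟩ := hz
    simp [mulVal_apply hm, mul_assoc, hs]
  · simp [mulVal_apply' _ _ z hz]

end mul

/-! ### Graphs with multiplication maps -/

/-- Graphs `r, s : E n ⇉ V` for `n ∈ ℕ` with a common vertex set `V` and injective, associative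
multiplication maps `E n ×_{s,r} E m → E k` for `k = n + m`, such that `E 0` is identified
with `V` through `vert`, and multiplication with vertices is the canonical map. -/
structure GraphSystem (V : Type u) where
  E : ℕ → Type v
  r : ∀ {n : ℕ}, E n → V
  s : ∀ {n : ℕ}, E n → V
  mul : ∀ {n m k : ℕ}, n + m = k → ∀ (x : E n) (y : E m), s x = r y → E k
  r_mul : ∀ {n m k : ℕ} (h : n + m = k) (x : E n) (y : E m) (hxy : s x = r y),
    r (mul h x y hxy) = r x
  s_mul : ∀ {n m k : ℕ} (h : n + m = k) (x : E n) (y : E m) (hxy : s x = r y),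
    s (mul h x y hxy) = s y
  mul_inj : ∀ {n m k : ℕ} (h : n + m = k) (x x' : E n) (y y' : E m) (hxy : s x = r y)
    (hxy' : s x' = r y'), mul h x y hxy = mul h x' y' hxy' → x = x' ∧ y = y'
  assoc : ∀ {n m l nm ml k : ℕ} (h₁ : n + m = nm) (h₂ : nm + l = k) (h₃ : m + l = ml)
    (h₄ : n + ml = k) (x : E n) (y : E m) (z : E l) (hxy : s x = r y) (hyz : s y = r z),
    mul h₂ (mul h₁ x y hxy) z ((s_mul h₁ x y hxy).trans hyz) =
      mul h₄ x (mul h₃ y z hyz) (hxy.trans (r_mul h₃ y z hyz).symm)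
  vert : V ≃ E 0
  r_vert : ∀ v, r (vert v) = v
  s_vert : ∀ v, s (vert v) = v
  vert_mul : ∀ {m : ℕ} (h : 0 + m = m) (x : E m), mul h (vert (r x)) x (s_vert _) = x
  mul_vert : ∀ {m : ℕ} (h : m + 0 = m) (x : E m), mul h x (vert (s x)) (r_vert _).symm = x

namespace GraphSystem

variable {V : Type u} (G : GraphSystem.{u, v} V)

/-- The multiplication as a map on the fibre product. -/
def mulMap {n m k : ℕ} (h : n + m = k) (p : {p : G.E n × G.E m // G.s p.1 = G.r p.2}) : G.E k :=
  G.mul h p.1.1 p.1.2 p.2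

theorem mulMap_injective {n m k : ℕ} (h : n + m = k) : Function.Injective (G.mulMap h) := by
  rintro ⟨⟨x, y⟩, hp⟩ ⟨⟨x', y'⟩, hp'⟩ hxy
  obtain ⟨rfl, rfl⟩ := G.mul_inj h x x' y y' hp hp' hxy
  rfl

variable [TopologicalSpace V] [DiscreteTopology V]

open GraphModule

/-- The function `a ∈ C₀(V)`, viewed as an element of the correspondence of the graph `E 0`. -/
def unitG : C₀(V, ℂ) ≃ₗ[ℂ] GraphModule (G.s (n := 0)) where
  toFun a := GraphModule.mk (fun e => a (G.s e)) (by
    have h : ∀ v, HasSum (fun e : {e : G.E 0 // G.s e = v} => ‖a (G.s e.1)‖ ^ 2) (‖a v‖ ^ 2) := by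
      intro v
      have hu : ∀ e : {e : G.E 0 // G.s e = v}, e = ⟨G.vert v, G.s_vert v⟩ := by
        rintro ⟨e, he⟩
        obtain ⟨w, rfl⟩ := G.vert.surjective e
        rw [G.s_vert] at he
        subst he
        rfl
      have := hasSum_single (f := fun e : {e : G.E 0 // G.s e = v} => ‖a (G.s e.1)‖ ^ 2)
        ⟨G.vert v, G.s_vert v⟩ fun e he => absurd (hu e) he
      simpa [G.s_vert] using this
    refine ⟨fun v => (h v).summable, ?_⟩
    simp only [(h _).tsum_eq]
    simpa using (tendsto_C0 a).norm.pow 2)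
  invFun x := mkC0 (fun v => val x (G.vert v)) (by
    refine squeeze_zero_norm (fun v => ?_) x.2
    rw [val_fib x v ⟨G.vert v, G.s_vert v⟩]
    exact lp.norm_apply_le_norm (by simp) (x.1 v) _)
  map_add' a b := val_ext fun e => rfl
  map_smul' c a := val_ext fun e => rfl
  left_inv a := by
    ext v
    change a (G.s (G.vert v)) = a v
    rw [G.s_vert]
  right_inv x := val_ext fun e => by
    obtain ⟨w, rfl⟩ := G.vert.surjective e
    simp [G.s_vert]

theorem val_unitG (a : C₀(V, ℂ)) (e : G.E 0) : val (G.unitG a) e = a (G.s e) := rfl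

theorem r_eq_s (e : G.E 0) : G.r e = G.s e := by
  obtain ⟨w, rfl⟩ := G.vert.surjective e
  rw [G.r_vert, G.s_vert]

theorem ip_unitG (a b : C₀(V, ℂ)) : ipG (G.unitG a) (G.unitG b) = star a * b := by
  ext v
  rw [ipG_apply, tsum_eq_single ⟨G.vert v, G.s_vert v⟩]
  · simp [val_unitG, G.s_vert]
  · rintro ⟨e, he⟩ hne
    obtain ⟨w, rfl⟩ := G.vert.surjective e
    rw [G.s_vert] at he
    subst he
    exact absurd rfl hne

/-- The multiplication of the correspondences associated to the graphs `E n` and `E m`. -/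
def mulH {n m k : ℕ} (h : n + m = k) : GraphModule (G.s (n := n)) →ₗ[ℂ]
    GraphModule (G.s (n := m)) →ₗ[ℂ] GraphModule (G.s (n := k)) :=
  mulG (m := G.mulMap h) (G.mulMap_injective h) fun p => G.s_mul h _ _ p.2

theorem val_mulH_apply {n m k : ℕ} (h : n + m = k) (f : GraphModule (G.s (n := n)))
    (g : GraphModule (G.s (n := m))) (x : G.E n) (y : G.E m) (hxy : G.s x = G.r y) :
    val (G.mulH h f g) (G.mul h x y hxy) = val f x * val g y :=
  mulVal_apply (G.mulMap_injective h) _ _ ⟨(x, y), hxy⟩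

theorem val_mulH_apply' {n m k : ℕ} (h : n + m = k) (f : GraphModule (G.s (n := n)))
    (g : GraphModule (G.s (n := m))) (z : G.E k)
    (hz : ∀ (x : G.E n) (y : G.E m) (hxy : G.s x = G.r y), G.mul h x y hxy ≠ z) :
    val (G.mulH h f g) z = 0 :=
  mulVal_apply' _ _ z fun ⟨p, hp⟩ => hz _ _ p.2 hp

theorem mulH_assoc {n m l nm ml k : ℕ} (h₁ : n + m = nm) (h₂ : nm + l = k) (h₃ : m + l = ml)
    (h₄ : n + ml = k) (f : GraphModule (G.s (n := n))) (g : GraphModule (G.s (n := m)))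
    (f' : GraphModule (G.s (n := l))) :
    G.mulH h₂ (G.mulH h₁ f g) f' = G.mulH h₄ f (G.mulH h₃ g f') := by
  refine val_ext fun w => ?_
  by_cases H : ∃ (x : G.E n) (y : G.E m) (z : G.E l) (hxy : G.s x = G.r y) (hyz : G.s y = G.r z),
      w = G.mul h₂ (G.mul h₁ x y hxy) z ((G.s_mul h₁ x y hxy).trans hyz)
  · obtain ⟨x, y, z, hxy, hyz, rfl⟩ := H
    rw [val_mulH_apply, val_mulH_apply, G.assoc h₁ h₂ h₃ h₄ x y z hxy hyz, val_mulH_apply, val_mulH_apply,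
      mul_assoc]
  · trans (0 : ℂ)
    · by_cases H1 : ∃ (t : G.E nm) (z : G.E l) (h : G.s t = G.r z), G.mul h₂ t z h = w
      · obtain ⟨t, z, htz, rfl⟩ := H1
        rw [val_mulH_apply, val_mulH_apply', zero_mul]
        rintro x y hxy rfl
        exact H ⟨x, y, z, hxy, (G.s_mul h₁ x y hxy).symm.trans htz, rfl⟩
      · exact G.val_mulH_apply' h₂ _ _ w fun t z htz h => H1 ⟨t, z, htz, h⟩
    · symm
      by_cases H1 : ∃ (x : G.E n) (t : G.E ml) (h : G.s x = G.r t), G.mul h₄ x t h = w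
      · obtain ⟨x, t, hxt, rfl⟩ := H1
        rw [val_mulH_apply, val_mulH_apply', mul_zero]
        rintro y z hyz rfl
        have hxy := hxt.trans (G.r_mul h₃ y z hyz)
        exact H ⟨x, y, z, hxy, hyz, (G.assoc h₁ h₂ h₃ h₄ x y z hxy hyz).symm⟩
      · exact G.val_mulH_apply' h₄ _ _ w fun x t hxt h => H1 ⟨x, t, hxt, h⟩

/-- The weak partial product system over `C₀(V)` built from the graphs `E n`. -/
def toWeakPartialProductSystem : WeakPartialProductSystem.{u, max u v} C₀(V, ℂ) where
  H n := GraphModule (G.s (n := n))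
  corr n := GraphModule.corr (G.r (n := n))
  mul h := G.mulH h
  ip_mul h := ip_mulG (G.mulMap_injective h) fun p => G.s_mul h _ _ p.2
  mul_lmul h := mulG_lmulG (G.mulMap_injective h) (fun p => G.s_mul h _ _ p.2)
    fun p => G.r_mul h _ _ p.2
  mul_rmul h := mulG_rmulG (G.mulMap_injective h) fun p => G.s_mul h _ _ p.2
  assoc := G.mulH_assoc
  unit := G.unitG
  ip_unit := G.ip_unitG
  lmul_unit a b := val_ext fun e => by
    change a (G.r e) * b (G.s e) = a (G.s e) * b (G.s e)
    rw [G.r_eq_s]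
  rmul_unit a b := rfl
  unit_mul h a x := val_ext fun e => by
    change val (G.mulH h (G.unitG a) x) e = a (G.r e) * val x e
    conv_lhs => rw [← G.vert_mul h e]
    rw [val_mulH_apply, val_unitG, G.s_vert]
  mul_unit h x a := val_ext fun e => by
    change val (G.mulH h x (G.unitG a)) e = val x e * a (G.s e)
    conv_lhs => rw [← G.mul_vert h e]
    rw [val_mulH_apply, val_unitG, G.s_vert]

end GraphSystem
/-! ### The category of a graph system and path categories -/

namespace GraphSystem

variable {V : Type u}

/-- The objects of the category `⊔ E n`, a copy of the vertex set. -/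
def Cat (_ : GraphSystem.{u, v} V) : Type u := V

variable (G : GraphSystem.{u, v} V)

/-- The arrows from `a` to `b` in the category `⊔ E n`. -/
structure Arrow (a b : V) : Type v where
  degree : ℕ
  edge : G.E degree
  source : G.s edge = a
  range : G.r edge = b

variable {G} in
theorem Arrow.ext_mul {n m l k k' : ℕ} {a b : V} (h : n + m = k) (h' : l = k') (hk : k = k')
    (x : G.E n) (y : G.E m) (hxy : G.s x = G.r y) (z : G.E l) {p q p' q'}
    (hz : ∀ h'' : n + m = l, G.mul h'' x y hxy = z) :
    (⟨k, G.mul h x y hxy, p, q⟩ : G.Arrow a b) = ⟨l, z, p', q'⟩ := by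
  subst h h' hk
  simp [← hz rfl]

/-- The category `⊔ E n` with object set `V`. Composition is the multiplication; the composite of
`x : a ⟶ b` and `y : b ⟶ c` is the product `y · x`. -/
instance : CategoryTheory.Category.{v} G.Cat where
  Hom a b := G.Arrow a b
  id a := ⟨0, G.vert a, G.s_vert a, G.r_vert a⟩
  comp x y := ⟨y.degree + x.degree, G.mul rfl y.edge x.edge (y.source.trans x.range.symm),
    (G.s_mul _ _ _ _).trans x.source, (G.r_mul _ _ _ _).trans y.range⟩
  id_comp := by
    rintro a b ⟨n, e, rfl, rfl⟩
    exact Arrow.ext_mul rfl rfl rfl _ _ _ _ fun h => G.mul_vert h e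
  comp_id := by
    rintro a b ⟨n, e, rfl, rfl⟩
    exact Arrow.ext_mul rfl rfl (zero_add n) _ _ _ _ fun h => G.vert_mul h e
  assoc := by
    rintro a b c d ⟨n, x, hx, hx'⟩ ⟨m, y, hy, hy'⟩ ⟨l, z, hz, hz'⟩
    exact (Arrow.ext_mul rfl rfl (by omega) _ _ _ _ fun h =>
      (G.assoc rfl h rfl rfl z y x (hz.trans hy'.symm) (hy.trans hx'.symm))).symm

open CategoryTheory

/-- A functor is an isomorphism of categories if it is bijective on objects and on arrows. -/
def IsIsoOfCategories {C : Type*} [Category C] {D : Type*} [Category D] (F : C ⥤ D) : Prop :=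
  Function.Bijective F.obj ∧ F.Full ∧ F.Faithful

/-- The category `⊔ E n` is isomorphic to the path category of a directed graph `Γ`. Nothing is
required about the degrees in `ℕ` of the generators. -/
def IsPathCategory : Prop :=
  ∃ (Γ : Type u) (_ : Quiver.{v} Γ) (F : Paths Γ ⥤ G.Cat), IsIsoOfCategories F

/-- The graded category `⊔ E n` is isomorphic to the path category of a directed graph `Γ` whose
generators have arbitrary positive degrees `d`: the arrows in `E n` correspond to the paths with
total degree `n`. -/
def IsWeightedPathCategory : Prop :=
  ∃ (Γ : Type u) (_ : Quiver.{v} Γ) (d : ∀ {a b : Γ}, (a ⟶ b) → ℕ) (F : Paths Γ ⥤ G.Cat),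
    (∀ {a b : Γ} (e : a ⟶ b), 0 < d e) ∧ IsIsoOfCategories F ∧
      ∀ {a b : Γ} (p : Quiver.Path a b),
        Arrow.degree (F.map (X := a) (Y := b) p) = p.addWeight d

end GraphSystem

end

end PPS

/-! Everything passes through one combinatorial property, `ComparesFactors`: if `x · y = x' · y'`
and `deg x ≤ deg x'`, then `x' = x · t` for some `t`. Composition is written in the opposite order,
so `x · y` is `y ≫ x` and left factors are final segments.

In a path category, two decompositions of one path have nested final segments
(`exists_comp_of_comp_eq`), and the degrees tell which segment is the shorter one. Conversely,
induction on the degree writes every arrow as a product of irreducible ones. Under `ComparesFactors`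
the last irreducible factors of two such products must agree and may be cancelled, so `E` is freely
generated by its irreducible arrows, with their own degrees as weights.

On the operator side, every graph system has a Fock representation, and this is a weak
representation. Left multiplication by `δ_x` is adjointable because `y ↦ x · y` is injective, so
that division by `x` is a contraction. Only the two containments have content. Suppose `x · y = x' ·
y'` with `0 < deg x < deg x'`, but that `x` does not divide `x'`. The matrix coefficient `⟨δ_y, ·
δ_y'⟩` vanishes on all operators with range in `S_d(H_d) F`, where `d = deg x' - deg x`, because `y`
has no left factor of degree `d`. On `S(δ_x)* S(δ_x')` it equals `⟨δ_{x·y}, δ_{x'·y'}⟩ ≠ 0`, which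
contradicts the containment (`comparesFactors_of_isPartialProductSystem`). Conversely, if
`ComparesFactors` holds and `deg x ≤ deg x'`, then either `x' = x · z`, and `S(δ_x)* S(δ_x') =
S_0(⟨δ_x, δ_x⟩) S(δ_z)`, or `x` and `x'` have no common multiple, and the product is zero
(`ComparesFactors.isPartialProductSystem`). -/

namespace PPS

/-! ### Comparison of factors in graded categories and in path categories. -/

namespace GraphSystem

open CategoryTheory

variable {V : Type u} (G : GraphSystem.{u, v} V)

variable {G} in
/-- The degree of an arrow of the category `⊔ E n`. -/
abbrev deg {a b : G.Cat} (x : a ⟶ b) : ℕ := Arrow.degree x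

/-- If an arrow has two factorizations, then one of the two left factors divides the other: the
one of smaller degree divides the one of larger degree. -/
def ComparesFactors : Prop :=
  ∀ {a b b' c : G.Cat} (y : a ⟶ b) (x : b ⟶ c) (y' : a ⟶ b') (x' : b' ⟶ c),
    y ≫ x = y' ≫ x' → deg x ≤ deg x' → ∃ t : b' ⟶ b, t ≫ x = x'

/-- The arrow of the category `⊔ E n` given by an edge. -/
def arrow {n : ℕ} (x : G.E n) {a b : V} (hs : G.s x = a) (hr : G.r x = b) :
    (show G.Cat from a) ⟶ (show G.Cat from b) :=
  (⟨n, x, hs, hr⟩ : G.Arrow a b)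

/-- The degree `k` is a free variable with `n + m = k`, so that two composites whose degrees are
equal only propositionally can be brought into the same `E k`. -/
theorem arrow_comp {n m k : ℕ} (h : n + m = k) (x : G.E n) (y : G.E m) {a b c : V}
    (hs : G.s y = a) (hr : G.r y = b) (hs' : G.s x = b) (hr' : G.r x = c) :
    G.arrow y hs hr ≫ G.arrow x hs' hr' = G.arrow (G.mul h x y (hs'.trans hr.symm))
      ((G.s_mul _ _ _ _).trans hs) ((G.r_mul _ _ _ _).trans hr') := by
  subst h
  rfl

theorem arrow_inj {n : ℕ} {x y : G.E n} {a b : V} {p q p' q'}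
    (h : G.arrow x (a := a) (b := b) p q = G.arrow y p' q') : x = y := by
  unfold arrow at h
  injection h

theorem exists_arrow {a b : G.Cat} (x : a ⟶ b) :
    ∃ (n : ℕ) (e : G.E n) (hs : G.s e = a) (hr : G.r e = b), x = G.arrow e hs hr := by
  obtain ⟨n, e, hs, hr⟩ := x
  exact ⟨n, e, hs, hr, rfl⟩

@[simp] theorem deg_arrow {n : ℕ} (x : G.E n) {a b : V} (hs : G.s x = a) (hr : G.r x = b) :
    deg (G.arrow x hs hr) = n := rfl

@[simp] theorem deg_comp {a b c : G.Cat} (y : a ⟶ b) (x : b ⟶ c) :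
    deg (y ≫ x) = deg x + deg y := rfl

theorem eq_of_deg_eq_zero {a b : G.Cat} (x : a ⟶ b) (h : deg x = 0) :
    ∃ hab : a = b, x = eqToHom hab := by
  obtain ⟨n, e, rfl, rfl, rfl⟩ := G.exists_arrow x
  change n = 0 at h
  subst h
  obtain ⟨v, rfl⟩ := G.vert.surjective e
  have hv : G.s (G.vert v) = G.r (G.vert v) := by rw [G.s_vert, G.r_vert]
  refine ⟨hv, ?_⟩
  -- The endpoints `s (vert v)` and `r (vert v)` are not variables; generalizing them allows the
  -- substitution that turns `eqToHom` into an identity.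
  have key : ∀ (a b : V) (ha : G.s (G.vert v) = a) (hb : G.r (G.vert v) = b) (hab : a = b),
      G.arrow (G.vert v) ha hb = eqToHom (C := G.Cat) hab := by
    rintro a b ha hb rfl
    rw [G.s_vert] at ha
    subst ha
    rfl
  exact key _ _ rfl rfl hv

/-- Additivity of degrees puts `y` and `y'` into the same `E m`, and there the injectivity of the
multiplication applies. -/
theorem comp_right_cancel {a b c : G.Cat} {y y' : a ⟶ b} {x : b ⟶ c} (h : y ≫ x = y' ≫ x) :
    y = y' := by
  obtain ⟨n, e, rfl, rfl, rfl⟩ := G.exists_arrow x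
  obtain ⟨m, f, rfl, hf, rfl⟩ := G.exists_arrow y
  obtain ⟨k, f', hf1, hf', rfl⟩ := G.exists_arrow y'
  have hd : m = k := by
    have : n + m = n + k := congrArg deg h
    omega
  subst hd
  rw [G.arrow_comp rfl, G.arrow_comp rfl] at h
  have := (G.mul_inj _ _ _ _ _ _ _ (G.arrow_inj h)).2
  subst this
  rfl

/-- Two decompositions of the same path: one of the two final segments is a part of the other. -/
theorem exists_comp_of_comp_eq {Γ : Type u} [Quiver.{v} Γ] {a b b' c : Γ} (p : Quiver.Path a b)
    (q : Quiver.Path b c) (p' : Quiver.Path a b') (q' : Quiver.Path b' c)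
    (h : p.comp q = p'.comp q') :
    (∃ t : Quiver.Path b' b, q' = t.comp q) ∨ ∃ t : Quiver.Path b b', q = t.comp q' := by
  induction q with
  | nil => exact Or.inl ⟨q', rfl⟩
  | cons q e ih =>
    cases q' with
    | nil => exact Or.inr ⟨q.cons e, rfl⟩
    | cons q' e' =>
      rw [Quiver.Path.comp_cons, Quiver.Path.comp_cons] at h
      -- The last edges agree and are cancelled. The equalities of edges and prefixes are
      -- heterogeneous until the penultimate vertices are identified.
      injection h with h1 h2 h3 h4
      subst h1
      obtain rfl := eq_of_heq h4
      obtain ⟨t, rfl⟩ | ⟨t, rfl⟩ := ih _ (eq_of_heq h3)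
      · exact Or.inl ⟨t, rfl⟩
      · exact Or.inr ⟨t, rfl⟩

theorem IsWeightedPathCategory.isPathCategory (h : G.IsWeightedPathCategory) :
    G.IsPathCategory := by
  obtain ⟨Γ, hΓ, _, F, _, hF, _⟩ := h
  exact ⟨Γ, hΓ, F, hF⟩

/-- The functor need not respect any grading: nestedness of final segments is a statement about
paths, and the degree in `E` only decides between the two alternatives. -/
theorem IsPathCategory.comparesFactors (h : G.IsPathCategory) : G.ComparesFactors := by
  obtain ⟨Γ, hΓ, F, hF, hfull, hfaith⟩ := h
  intro a b b' c y x y' x' hxy hd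
  obtain ⟨a, rfl⟩ := hF.2 a
  obtain ⟨b, rfl⟩ := hF.2 b
  obtain ⟨b', rfl⟩ := hF.2 b'
  obtain ⟨c, rfl⟩ := hF.2 c
  obtain ⟨y, rfl⟩ := F.map_surjective y
  obtain ⟨x, rfl⟩ := F.map_surjective x
  obtain ⟨y', rfl⟩ := F.map_surjective y'
  obtain ⟨x', rfl⟩ := F.map_surjective x'
  rw [← F.map_comp, ← F.map_comp] at hxy
  obtain ⟨t, ht⟩ | ⟨t, ht⟩ := exists_comp_of_comp_eq y x y' x' (F.map_injective hxy)
  · exact ⟨F.map t, by rw [← F.map_comp]; exact congrArg _ ht.symm⟩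
  -- Here `x` is a multiple of `x'`. As `deg x ≤ deg x'`, the cofactor has degree zero and is an
  -- identity, so the two factors agree.
  · have e : F.map x = F.map (X := b) (Y := b') t ≫ F.map x' := by
      rw [← F.map_comp]; exact congrArg _ ht
    rw [e, deg_comp] at hd
    obtain ⟨hb, h0⟩ := G.eq_of_deg_eq_zero (F.map (X := b) (Y := b') t) (by omega)
    refine ⟨eqToHom hb.symm, ?_⟩
    rw [e, h0]
    simp

/-! ### Unique factorization into irreducible arrows. -/

/-- An arrow of positive degree that is not a product of arrows of positive degree. -/
def IsIrreducible {a b : G.Cat} (x : a ⟶ b) : Prop :=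
  0 < deg x ∧ ∀ {c : G.Cat} (y : a ⟶ c) (z : c ⟶ b), y ≫ z = x → deg y = 0 ∨ deg z = 0

/-- The graph of irreducible arrows. -/
def IrreducibleGraph (_ : GraphSystem.{u, v} V) : Type u := V

variable {G} in
/-- A vertex of the graph of irreducible arrows as an object of the category `⊔ E n`. -/
def IrreducibleGraph.toCat (a : G.IrreducibleGraph) : G.Cat := a

instance : Quiver.{v} G.IrreducibleGraph where
  Hom a b := {x : a.toCat ⟶ b.toCat // G.IsIrreducible x}

variable {G} in
/-- The arrow of the category `⊔ E n` underlying an edge of the graph of irreducible arrows. -/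
def IrreducibleGraph.val {a b : G.IrreducibleGraph} (e : a ⟶ b) : a.toCat ⟶ b.toCat :=
  Subtype.val e

variable {G} in
theorem IrreducibleGraph.isIrreducible {a b : G.IrreducibleGraph} (e : a ⟶ b) :
    G.IsIrreducible (val e) :=
  Subtype.property e

open IrreducibleGraph

variable {G} in
/-- The product of a path of irreducible arrows. -/
def pathProd {a : G.IrreducibleGraph} :
    ∀ {b : G.IrreducibleGraph}, Quiver.Path a b → (a.toCat ⟶ b.toCat)
  | _, .nil => 𝟙 _
  | _, .cons p e => pathProd p ≫ val e

theorem pathProd_comp {a b c : G.IrreducibleGraph} (p : Quiver.Path a b) (q : Quiver.Path b c) :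
    pathProd (p.comp q) = pathProd p ≫ pathProd q := by
  induction q with
  | nil => exact (Category.comp_id _).symm
  | cons q e ih => simp [pathProd, ih]

/-- The functor from the path category of the graph of irreducible arrows. -/
def pathProdFunctor : Paths G.IrreducibleGraph ⥤ G.Cat where
  obj := toCat
  map p := pathProd p
  map_id _ := rfl
  map_comp p q := G.pathProd_comp p q

theorem deg_pathProd {a b : G.IrreducibleGraph} (p : Quiver.Path a b) :
    deg (pathProd p) = p.addWeight fun e => deg (val e) := by
  induction p with
  | nil => rw [Quiver.Path.addWeight_nil]; rfl
  | cons p e ih => rw [pathProd, deg_comp, ih, Quiver.Path.addWeight_cons, add_comm]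

/-- A reducible arrow of positive degree splits into two factors of strictly smaller degree, so
strong induction on the degree applies. Comparison of factors is needed only for uniqueness. -/
theorem exists_pathProd_eq {a b : G.IrreducibleGraph} (x : a.toCat ⟶ b.toCat) :
    ∃ p : Quiver.Path a b, pathProd p = x := by
  induction hn : deg x using Nat.strong_induction_on generalizing a b with
  | _ n ih =>
    by_cases hx : G.IsIrreducible x
    · exact ⟨Quiver.Path.nil.cons (⟨x, hx⟩ : a ⟶ b), Category.id_comp x⟩
    by_cases h0 : deg x = 0
    · obtain ⟨hab, h⟩ := G.eq_of_deg_eq_zero x h0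
      obtain rfl : a = b := hab
      exact ⟨Quiver.Path.nil, h.symm⟩
    · have : ∃ (c : G.IrreducibleGraph) (y : a.toCat ⟶ c.toCat) (z : c.toCat ⟶ b.toCat),
          y ≫ z = x ∧ deg y ≠ 0 ∧ deg z ≠ 0 := by
        by_contra! H
        exact hx ⟨Nat.pos_of_ne_zero h0, fun y z h => or_iff_not_imp_left.2 (H _ y z h)⟩
      obtain ⟨c, y, z, rfl, hy, hz⟩ := this
      rw [deg_comp] at hn
      obtain ⟨p, rfl⟩ := ih (deg y) (by omega) y rfl
      obtain ⟨q, rfl⟩ := ih (deg z) (by omega) z rfl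
      exact ⟨p.comp q, G.pathProd_comp p q⟩

variable {G}

/-- Comparison gives `t ≫ e = e'`. Since `e'` is irreducible and `e` has positive degree, `t` has
degree zero, hence is an identity. -/
theorem ComparesFactors.val_eq_of_deg_le (hG : G.ComparesFactors) {a b c c' : G.IrreducibleGraph}
    (p : Quiver.Path a c) (e : c ⟶ b) (p' : Quiver.Path a c') (e' : c' ⟶ b)
    (h : pathProd (p.cons e) = pathProd (p'.cons e')) (hd : deg (val e) ≤ deg (val e')) :
    ∃ hc : c' = c, hc ▸ e' = e := by
  obtain ⟨t, ht⟩ := hG _ _ _ _ h hd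
  have h0 : deg t = 0 := ((isIrreducible e').2 t _ ht).resolve_right (isIrreducible e).1.ne'
  obtain ⟨hc, rfl⟩ := G.eq_of_deg_eq_zero t h0
  obtain rfl : c' = c := hc
  exact ⟨rfl, Subtype.ext (ht.symm.trans (Category.id_comp _))⟩

/-- The last edges of two paths with the same product agree, whichever has the smaller degree;
cancelling them leaves shorter paths with equal products. -/
theorem ComparesFactors.pathProd_injective (hG : G.ComparesFactors) {a b : G.IrreducibleGraph}
    (p q : Quiver.Path a b) (h : pathProd p = pathProd q) : p = q := by
  -- A non-empty path has positive degree, so its product is never an identity.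
  have h0 : ∀ {c : G.IrreducibleGraph} (p : Quiver.Path a c) (e : c ⟶ a),
      pathProd (p.cons e) ≠ pathProd .nil := fun p e h => by
    have h1 : deg (val e) + deg (pathProd p) = 0 := congrArg deg h
    have h2 := (isIrreducible e).1
    omega
  induction p with
  | nil =>
    cases q with
    | nil => rfl
    | cons q e => exact absurd h.symm (h0 q e)
  | cons p e ih =>
    cases q with
    | nil => exact absurd h (h0 p e)
    | cons q e' =>
      rcases le_total (deg (val e)) (deg (val e')) with hd | hd
      · obtain ⟨rfl, rfl⟩ := hG.val_eq_of_deg_le p e q e' h hd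
        rw [ih q (G.comp_right_cancel h)]
      · obtain ⟨rfl, rfl⟩ := hG.val_eq_of_deg_le q e' p e h.symm hd
        rw [ih q (G.comp_right_cancel h)]

theorem ComparesFactors.isWeightedPathCategory (hG : G.ComparesFactors) :
    G.IsWeightedPathCategory :=
  ⟨G.IrreducibleGraph, inferInstance, fun e => deg (val e), G.pathProdFunctor,
    fun e => (isIrreducible e).1, ⟨Function.bijective_id, ⟨fun x => G.exists_pathProd_eq x⟩,
      ⟨fun {_ _ p q} h => hG.pathProd_injective p q h⟩⟩, fun p => G.deg_pathProd p⟩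

end GraphSystem
end PPS

namespace PPS

noncomputable section

/-! ### Operators on Hilbert module direct sums -/

namespace HilbertSum

open HilbertModule

variable {A : Type u} [NonUnitalCStarAlgebra A] {ι κ : Type w} {M : ι → Type v}
  [∀ i, NormedAddCommGroup (M i)] [∀ i, NormedSpace ℂ (M i)] [∀ i, HilbertModule A (M i)]
  {N : κ → Type v}
  [∀ i, NormedAddCommGroup (N i)] [∀ i, NormedSpace ℂ (N i)] [∀ i, HilbertModule A (N i)]

theorem coords_incl_same (i : ι) (x : M i) : coords (incl A M i x) i = x := by
  classical
  exact Pi.single_eq_same (M := M) i x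

theorem coords_incl_of_ne {i j : ι} (hij : i ≠ j) (y : M j) : coords (incl A M j y) i = 0 := by
  classical
  exact Pi.single_eq_of_ne (M := M) hij y

theorem ip_incl_left (i : ι) (x : M i) (u : HilbertSum A M) :
    ip (A := A) (incl A M i x) u = ip (A := A) x (coords u i) := by
  change ipSum _ _ = _
  rw [ipSum_apply, tsum_eq_single i fun j hj => ?_]
  · rw [coords_incl_same]
  · rw [coords_incl_of_ne hj]
    simp

theorem ip_incl_incl (i : ι) (x y : M i) :
    ip (A := A) (incl A M i x) (incl A M i y) = ip (A := A) x y := by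
  rw [ip_incl_left, coords_incl_same]

theorem ip_incl_incl_of_ne {i j : ι} (hij : i ≠ j) (x : M i) (y : M j) :
    ip (A := A) (incl A M i x) (incl A M j y) = 0 := by
  rw [ip_incl_left, coords_incl_of_ne hij, map_zero]

theorem ext_ip_incl {u w : HilbertSum A M}
    (h : ∀ i x, ip (A := A) (incl A M i x) u = ip (A := A) (incl A M i x) w) : u = w :=
  ext_coords fun i => ext_ip A fun x => by rw [← ip_incl_left, h, ip_incl_left]

/-- Matrix coefficients between summands suffice. They determine `T` and `S` on each summand; moving
to the adjoints then tests `star T u` and `star S u`, for arbitrary `u`, against summands only. So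
density of the finite sums is not needed. -/
theorem adjointable_ext {T S : Adjointable A (HilbertSum A M)}
    (h : ∀ i x j y, ip (A := A) (incl A M i x) (T.1 (incl A M j y)) =
      ip (A := A) (incl A M i x) (S.1 (incl A M j y))) : T = S := by
  refine star_injective (Subtype.ext (ContinuousLinearMap.ext fun u => ext_ip_incl fun j y => ?_))
  rw [← isAdj_star T, ← isAdj_star S, ext_ip_incl fun i x => h i x j y]

/-- A linear map between families that satisfies a norm bound on finite sets of indices defines a
bounded operator between the Hilbert module direct sums. -/
def mapL (L : (∀ i, M i) →ₗ[ℂ] ∀ k, N k) (g : Finset κ → Finset ι) (c : ℝ)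
    (hg : ∀ t₀, ∃ s₀, ∀ s, Disjoint s s₀ → Disjoint (g s) t₀)
    (hL : ∀ s y, ‖ipFin A N s (L y) (L y)‖ ≤ c ^ 2 * ‖ipFin A M (g s) y y‖) (hc : 0 ≤ c) :
    HilbertSum A M →L[ℂ] HilbertSum A N :=
  have hL' : ∀ s y, √‖ipFin A N s (L y) (L y)‖ ≤ c * √‖ipFin A M (g s) y y‖ := fun s y => by
    refine (Real.sqrt_le_sqrt (hL s y)).trans ?_
    rw [Real.sqrt_mul (by positivity), Real.sqrt_sq hc]
  LinearMap.mkContinuous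
    { toFun := fun ξ => mk (L (coords ξ)) (by
        rw [summable_ip_iff]
        intro ε hε
        -- Cauchy criterion: by `hg`, index sets that avoid `s₀` are sent by `g` to index sets that
        -- avoid `t₀`, where the tail of `ξ` is small. The denominator is `c + 1` because `c` may be
        -- zero.
        obtain ⟨t₀, ht₀⟩ := (summable_ip_iff A M _).1 ξ.summable_self (ε / (c + 1))
          (by positivity)
        obtain ⟨s₀, hs₀⟩ := hg t₀
        refine ⟨s₀, fun s hs => (hL' s _).trans_lt ?_⟩
        have h1 := ht₀ _ (hs₀ s hs)
        rw [lt_div_iff₀ (by positivity)] at h1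
        refine lt_of_le_of_lt ?_ h1
        nlinarith [Real.sqrt_nonneg ‖ipFin A M (g s) (coords ξ) (coords ξ)‖])
      map_add' := fun ξ η => ext_coords fun k => by simp
      map_smul' := fun a ξ => ext_coords fun k => by simp }
    c fun ξ => norm_le_of_forall _ _ fun s => (hL' s _).trans (by
      gcongr
      exact sqrt_ipFin_le _ _)

@[simp] theorem coords_mapL {L : (∀ i, M i) →ₗ[ℂ] ∀ k, N k} {g : Finset κ → Finset ι} {c : ℝ}
    {hg hL hc} (ξ : HilbertSum A M) :
    coords (mapL (A := A) L g c hg hL hc ξ) = L (coords ξ) := rfl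

theorem norm_mapL_le {L : (∀ i, M i) →ₗ[ℂ] ∀ k, N k} {g : Finset κ → Finset ι} {c : ℝ}
    (hg hL hc) : ‖mapL (A := A) L g c hg hL hc‖ ≤ c := by
  unfold mapL
  exact LinearMap.mkContinuous_norm_le _ hc _

end HilbertSum

/-! ### Creation operators on the Fock module -/

namespace WeakPartialProductSystem

open HilbertModule Correspondence HilbertSum

variable {A : Type u} [NonUnitalCStarAlgebra A] (W : WeakPartialProductSystem.{u, v} A)

/-- The left multiplications on finite sums of the correspondences `H m` by `x` are bounded
by `‖x‖`. -/
def BoundedLeftMul : Prop :=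
  ∀ (n : ℕ) (x : W.H n) (t : Finset ℕ) (y : ∀ m, W.H m),
    ‖∑ m ∈ t, ip (A := A) (W.mul rfl x (y m)) (W.mul rfl x (y m))‖ ≤
      ‖x‖ ^ 2 * ‖∑ m ∈ t, ip (A := A) (y m) (y m)‖

/-- Left multiplication by `x` on families of elements of the correspondences `H m`. -/
def creationFun (n : ℕ) : W.H n →ₗ[ℂ] (∀ m, W.H m) →ₗ[ℂ] ∀ k, W.H k :=
  LinearMap.mk₂ ℂ
    -- Subtraction is truncated, so the coordinates below `n` have to be set to zero separately.
    (fun x y k => if h : n ≤ k then W.mul (Nat.add_sub_of_le h) x (y (k - n)) else 0)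
    (by intros; ext k; by_cases h : n ≤ k <;> simp [h])
    (by intros; ext k; by_cases h : n ≤ k <;> simp [h])
    (by intros; ext k; by_cases h : n ≤ k <;> simp [h])
    (by intros; ext k; by_cases h : n ≤ k <;> simp [h])

/-- Stated for any `m` with `n + m = k`, which avoids transport along `n + (k - n) = k`. -/
theorem creationFun_apply {n m k : ℕ} (h : n + m = k) (x : W.H n) (y : ∀ m, W.H m) :
    W.creationFun n x y k = W.mul h x (y m) := by
  obtain rfl : m = k - n := by omega
  exact dif_pos (by omega)

theorem creationFun_of_lt {n k : ℕ} (h : k < n) (x : W.H n) (y : ∀ m, W.H m) :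
    W.creationFun n x y k = 0 :=
  dif_neg (by omega)

/-- Only degrees `k = n + m` contribute. The reindexed sum is the one that `BoundedLeftMul`
estimates. -/
theorem ipFin_creationFun (n : ℕ) (x : W.H n) (s : Finset ℕ) (y : ∀ m, W.H m) :
    ipFin A W.H s (W.creationFun n x y) (W.creationFun n x y) =
      ∑ m ∈ s.preimage (n + ·) (add_right_injective n).injOn,
        ip (A := A) (W.mul rfl x (y m)) (W.mul rfl x (y m)) := by
  rw [ipFin_apply, ← Finset.sum_preimage (n + ·) s (add_right_injective n).injOn]
  · exact Finset.sum_congr rfl fun m _ => by rw [W.creationFun_apply rfl]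
  · intro k _ hk
    rw [W.creationFun_of_lt, map_zero]
    by_contra! h
    exact hk ⟨k - n, by simp only; omega⟩

variable {W}

/-- The creation operator on the Fock module for an element of `H n`. -/
def creationOp (hb : W.BoundedLeftMul) {n : ℕ} (x : W.H n) : W.Fock →L[ℂ] W.Fock :=
  mapL (W.creationFun n x) (fun s => s.preimage (n + ·) (add_right_injective n).injOn) ‖x‖
    (fun t₀ => ⟨t₀.image (n + ·), fun s hs => by
      rw [Finset.disjoint_left] at hs ⊢
      intro m hm hm'
      exact hs (Finset.mem_preimage.1 hm) (Finset.mem_image_of_mem _ hm')⟩)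
    (fun s y => by rw [ipFin_creationFun]; exact hb n x _ y) (norm_nonneg x)

theorem norm_creationOp_le (hb : W.BoundedLeftMul) {n : ℕ} (x : W.H n) :
    ‖creationOp hb x‖ ≤ ‖x‖ :=
  norm_mapL_le _ _ _

/-- The creation operators on the Fock module, as a bounded linear map. -/
def creation (hb : W.BoundedLeftMul) (n : ℕ) : W.H n →L[ℂ] W.Fock →L[ℂ] W.Fock :=
  LinearMap.mkContinuous
    { toFun := creationOp hb
      map_add' := fun x x' => ContinuousLinearMap.ext fun ξ => ext_coords fun k => by
        simp [creationOp]
      map_smul' := fun c x => ContinuousLinearMap.ext fun ξ => ext_coords fun k => by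
        simp [creationOp] }
    1 fun x => by rw [one_mul]; exact norm_creationOp_le hb x

theorem coords_creation (hb : W.BoundedLeftMul) {n : ℕ} (x : W.H n) (ξ : W.Fock) :
    coords (creation hb n x ξ) = W.creationFun n x (coords ξ) := rfl

theorem creation_incl (hb : W.BoundedLeftMul) {n : ℕ} (x : W.H n) (m : ℕ) (y : W.H m) :
    creation hb n x (incl A W.H m y) = incl A W.H (n + m) (W.mul rfl x y) := by
  refine ext_coords fun k => ?_
  rw [coords_creation]
  by_cases hk : n ≤ k
  · obtain ⟨l, rfl⟩ := Nat.exists_eq_add_of_le hk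
    rw [W.creationFun_apply rfl]
    by_cases h : l = m
    · subst h
      rw [coords_incl_same, coords_incl_same]
    · rw [coords_incl_of_ne h, coords_incl_of_ne (by omega), map_zero]
  · rw [W.creationFun_of_lt (by omega), coords_incl_of_ne (by omega)]

/-- A creation operator has an adjoint if the left multiplications have adjoints with a uniform
norm bound on finite sums. -/
theorem creation_mem_adjointable (hb : W.BoundedLeftMul) {n : ℕ} (x : W.H n)
    (D : ∀ m, W.H (n + m) →ₗ[ℂ] W.H m)
    (hD : ∀ m (y : W.H m) (z : W.H (n + m)),
      ip (A := A) (W.mul rfl x y) z = ip (A := A) y (D m z))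
    (hDb : ∀ (t : Finset ℕ) (z : ∀ k, W.H k),
      ‖∑ m ∈ t, ip (A := A) (D m (z (n + m))) (D m (z (n + m)))‖ ≤
        ‖∑ m ∈ t, ip (A := A) (z (n + m)) (z (n + m))‖) :
    creation hb n x ∈ Adjointable A W.Fock := by
  -- The candidate for the adjoint lowers degrees by `n` and kills the coordinates below `n`.
  let L : (∀ m, W.H m) →ₗ[ℂ] ∀ k, W.H k := LinearMap.pi fun m => D m ∘ₗ LinearMap.proj (n + m)
  refine ⟨mapL L (fun s => s.image (n + ·)) 1
    (fun t₀ => ⟨t₀.preimage (n + ·) (add_right_injective n).injOn, fun s hs => ?_⟩)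
    (fun s y => ?_) zero_le_one, fun ξ η => ?_⟩
  · rw [Finset.disjoint_left] at hs ⊢
    intro k hk hk'
    obtain ⟨m, hm, rfl⟩ := Finset.mem_image.1 hk
    exact hs hm (Finset.mem_preimage.2 hk')
  · rw [one_pow, one_mul, ipFin_apply, ipFin_apply,
      Finset.sum_image (add_right_injective n).injOn]
    exact hDb s y
  · change ∑' k, ip (A := A) (W.creationFun n x (coords ξ) k) (coords η k) =
      ∑' m, ip (A := A) (coords ξ m) (D m (coords η (n + m)))
    -- The terms with `k < n` vanish, so the sum over `k` may be reindexed by `k = n + m`.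
    rw [← (add_right_injective n).tsum_eq]
    · exact tsum_congr fun m => by rw [W.creationFun_apply rfl, hD]
    · intro k hk
      by_contra h
      refine hk ?_
      simp only
      rw [W.creationFun_of_lt, map_zero, LinearMap.zero_apply]
      by_contra! h'
      exact h ⟨k - n, by simp only; omega⟩

/-- It suffices to check that creation operators have adjoints on a dense subspace. -/
theorem creation_mem_adjointable_of_dense (hb : W.BoundedLeftMul) {n : ℕ} {D : Set (W.H n)}
    (hD : (Submodule.span ℂ D).topologicalClosure = ⊤)
    (h : ∀ x ∈ D, creation hb n x ∈ Adjointable A W.Fock) (x : W.H n) :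
    creation hb n x ∈ Adjointable A W.Fock := by
  -- The adjointable operators are complete, hence norm-closed among bounded operators, so their
  -- preimage under the continuous map `creation hb n` is a closed subspace.
  have hcl : IsClosed (Adjointable A W.Fock : Set (W.Fock →L[ℂ] W.Fock)) :=
    (completeSpace_coe_iff_isComplete.1
      (inferInstanceAs (CompleteSpace (Adjointable A W.Fock)))).isClosed
  let P : Submodule ℂ (W.H n) :=
    (Subalgebra.toSubmodule (Adjointable A W.Fock)).comap (creation hb n).toLinearMap
  have hP : (Submodule.span ℂ D).topologicalClosure ≤ P :=
    Submodule.topologicalClosure_minimal _ (Submodule.span_le.2 h)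
      (hcl.preimage (creation hb n).continuous)
  rw [hD] at hP
  exact hP trivial

/-- The Fock representation of a weak partial product system with adjointable creation operators. -/
def fock (hb : W.BoundedLeftMul)
    (ha : ∀ n (x : W.H n), creation hb n x ∈ Adjointable A W.Fock) (n : ℕ) :
    W.H n →ₗ[ℂ] Adjointable A W.Fock where
  toFun x := ⟨creation hb n x, ha n x⟩
  map_add' x y := Subtype.ext (map_add _ x y)
  map_smul' c x := Subtype.ext (map_smul _ c x)

theorem isFockRepresentation_fock (hb : W.BoundedLeftMul)
    (ha : ∀ n (x : W.H n), creation hb n x ∈ Adjointable A W.Fock) :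
    W.IsFockRepresentation (fock hb ha) := fun _ m x y => creation_incl hb x m y

theorem continuous_fock (hb : W.BoundedLeftMul)
    (ha : ∀ n (x : W.H n), creation hb n x ∈ Adjointable A W.Fock) (n : ℕ) :
    Continuous (fock hb ha n) :=
  (creation hb n).continuous.subtype_mk _

variable {S : ∀ n, W.H n →ₗ[ℂ] Adjointable A W.Fock}

theorem IsFockRepresentation.apply_incl (hS : W.IsFockRepresentation S) {n m k : ℕ}
    (h : n + m = k) (x : W.H n) (y : W.H m) :
    (S n x).1 (incl A W.H m y) = incl A W.H k (W.mul h x y) := by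
  subst h
  exact hS n m x y

theorem ip_star_mul {n m : ℕ} (x : W.H n) (x' : W.H m) (ξ η : W.Fock) :
    ip (A := A) ξ ((star (S n x) * S m x').1 η) = ip (A := A) ((S n x).1 ξ) ((S m x').1 η) :=
  (isAdj_star (S n x) _ _).symm

/-- The Fock representation is a weak representation. -/
theorem IsFockRepresentation.isWeakRepresentation (hS : W.IsFockRepresentation S) :
    W.IsWeakRepresentation S where
  mul {n m k} h x y := adjointable_ext fun i a j b => by
    change ip _ ((S n x).1 ((S m y).1 _)) = _
    rw [hS.apply_incl rfl, hS.apply_incl rfl, hS.apply_incl (show k + j = n + (m + j) by omega),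
      ← W.assoc h (by omega) rfl rfl]
  star_mul n x y := adjointable_ext fun i a j b => by
    rw [ip_star_mul, hS.apply_incl rfl, hS.apply_incl rfl, hS.apply_incl (zero_add j)]
    -- On the diagonal this is the isometry property of the multiplication; off the diagonal both
    -- sides vanish for reasons of degree.
    by_cases hij : i = j
    · subst hij
      rw [ip_incl_incl, ip_incl_incl, W.ip_mul, W.unit_mul]
    · rw [ip_incl_incl_of_ne hij, ip_incl_incl_of_ne (by omega)]

/-- To show that `S n (H n)* · S m (H m)` is contained in a closed subspace, it suffices to
consider dense subspaces of `H n` and `H m`. -/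
theorem closedProd_star_range_le {B : Type w} [NonUnitalCStarAlgebra B]
    {ω : ∀ n, W.H n →ₗ[ℂ] B} (hω : ∀ n, Continuous (ω n)) {n m : ℕ} {D : Set (W.H n)}
    {D' : Set (W.H m)} (hD : (Submodule.span ℂ D).topologicalClosure = ⊤)
    (hD' : (Submodule.span ℂ D').topologicalClosure = ⊤) {K : Submodule ℂ B}
    (hK : IsClosed (K : Set B)) (h : ∀ x ∈ D, ∀ y ∈ D', star (ω n x) * ω m y ∈ K) :
    closedProd (star (Set.range (ω n))) (Set.range (ω m)) ≤ K := by
  have h1 : ∀ x ∈ D, ∀ y, star (ω n x) * ω m y ∈ K := fun x hx => by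
    let P : Submodule ℂ (W.H m) :=
      K.comap ((LinearMap.mulLeft ℂ (star (ω n x))) ∘ₗ ω m)
    have hP : (Submodule.span ℂ D').topologicalClosure ≤ P :=
      Submodule.topologicalClosure_minimal _ (Submodule.span_le.2 (h x hx))
        (hK.preimage (continuous_const.mul (hω m)))
    rw [hD'] at hP
    exact fun y => hP trivial
  have h2 : ∀ x y, star (ω n x) * ω m y ∈ K := fun x y => by
    -- The dependence on `x` is conjugate-linear, so this subspace is not the preimage of `K` under
    -- a complex-linear map; closure under scalars uses `star c`.
    let P : Submodule ℂ (W.H n) :=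
      { carrier := {x | star (ω n x) * ω m y ∈ K}
        zero_mem' := by simp
        add_mem' := fun {a b} ha hb => by
          simpa [add_mul] using K.add_mem ha hb
        smul_mem' := fun c a ha => by
          simpa [smul_mul_assoc] using K.smul_mem (star c) ha }
    have hP : (Submodule.span ℂ D).topologicalClosure ≤ P :=
      Submodule.topologicalClosure_minimal _ (Submodule.span_le.2 fun x hx => h1 x hx y)
        (hK.preimage ((hω n).star.mul continuous_const))
    rw [hD] at hP
    exact hP trivial
  refine Submodule.topologicalClosure_minimal _ (Submodule.span_le.2 ?_) hK
  rintro _ ⟨a, ⟨x, hx⟩, _, ⟨y, rfl⟩, rfl⟩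
  have := h2 x y
  rwa [hx, star_star] at this

end WeakPartialProductSystem

end

end PPS

namespace PPS

noncomputable section

/-! ### Multiplication operators on graph correspondences -/

namespace GraphModule

section edge

variable {V : Type u} {E₁ E₂ E₃ : Type v} {s₁ : E₁ → V} {r₂ s₂ : E₂ → V} {s₃ : E₃ → V}
  {m : {p : E₁ × E₂ // s₁ p.1 = r₂ p.2} → E₃}

open scoped Classical in
/-- The function `y ↦ f (e · y)`, extended by `0` to the edges that are not composable with `e`. -/
def divVal (m : {p : E₁ × E₂ // s₁ p.1 = r₂ p.2} → E₃) (e : E₁) (f : E₃ → ℂ) (y : E₂) : ℂ :=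
  if h : s₁ e = r₂ y then f (m ⟨(e, y), h⟩) else 0

theorem divVal_of_eq (e : E₁) (f : E₃ → ℂ) (y : E₂) (h : s₁ e = r₂ y) :
    divVal m e f y = f (m ⟨(e, y), h⟩) := dif_pos h

theorem divVal_of_ne (e : E₁) (f : E₃ → ℂ) (y : E₂) (h : s₁ e ≠ r₂ y) :
    divVal m e f y = 0 := dif_neg h

/-- Multiplication by an edge, on the edges with source `v`. -/
def mulEdge (hs : ∀ p, s₃ (m p) = s₂ p.1.2) (e : E₁) (v : V)
    (y : {y : {y // s₂ y = v} | s₁ e = r₂ y}) : {z // s₃ z = v} :=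
  ⟨m ⟨(e, y.1.1), y.2⟩, (hs _).trans y.1.2⟩

theorem mulEdge_injective (hm : Function.Injective m) (hs : ∀ p, s₃ (m p) = s₂ p.1.2) (e : E₁)
    (v : V) : Function.Injective (mulEdge hs e v) := fun y y' h => by
  have h1 := hm (congrArg Subtype.val h)
  simp only [Subtype.mk.injEq, Prod.mk.injEq, true_and] at h1
  exact Subtype.ext (Subtype.ext h1)

/-- Multiplication by `e` is injective and preserves sources, so the squares on the left are some of
the terms of the series for `‖f.1 v‖ ^ 2`. This makes division by `e` both well defined and
contractive. -/
theorem exists_hasSum_divVal (hm : Function.Injective m) (hs : ∀ p, s₃ (m p) = s₂ p.1.2)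
    (e : E₁) (f : GraphModule s₃) (v : V) :
    ∃ a ≤ ‖f.1 v‖ ^ 2, HasSum (fun y : {y // s₂ y = v} => ‖divVal m e (val f) y‖ ^ 2) a := by
  have h1 : Summable fun y => ‖val f (mulEdge hs e v y).1‖ ^ 2 :=
    (hasSum_sq f v).summable.comp_injective (mulEdge_injective hm hs e v)
  refine ⟨∑' y, ‖val f (mulEdge hs e v y).1‖ ^ 2, ?_, (hasSum_subtype_iff_of_support_subset
    (s := {y : {y // s₂ y = v} | s₁ e = r₂ y}) fun y hy => ?_).1
      (h1.hasSum.congr_fun fun y => ?_)⟩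
  · rw [← (hasSum_sq f v).tsum_eq]
    exact h1.tsum_le_tsum_of_inj _ (mulEdge_injective hm hs e v) (fun _ _ => by positivity)
      (fun _ => le_rfl) (hasSum_sq f v).summable
  · by_contra h
    exact hy (by simp [divVal_of_ne e (val f) y.1 h])
  · simp only [Function.comp_apply]
    rw [divVal_of_eq e (val f) y.1.1 y.2]
    rfl

/-- The adjoint of the multiplication by the characteristic function of an edge. -/
def divG (hm : Function.Injective m) (hs : ∀ p, s₃ (m p) = s₂ p.1.2) (e : E₁) :
    GraphModule s₃ →ₗ[ℂ] GraphModule s₂ where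
  toFun f := GraphModule.mk (divVal m e (val f)) (by
    choose a ha h using exists_hasSum_divVal hm hs e f
    refine ⟨fun v => (h v).summable, squeeze_zero (fun v => tsum_nonneg fun _ => by positivity)
      (fun v => (h v).tsum_eq.trans_le (ha v)) ?_⟩
    simpa using Filter.Tendsto.pow f.2 2)
  map_add' f g := val_ext fun y => by
    change divVal m e (val f + val g) y = divVal m e (val f) y + divVal m e (val g) y
    by_cases h : s₁ e = r₂ y
    · simp [divVal_of_eq _ _ _ h]
    · simp [divVal_of_ne _ _ _ h]
  map_smul' c f := val_ext fun y => by
    change divVal m e (c • val f) y = c • divVal m e (val f) y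
    by_cases h : s₁ e = r₂ y
    · simp [divVal_of_eq _ _ _ h]
    · simp [divVal_of_ne _ _ _ h]

theorem val_divG (hm : Function.Injective m) (hs : ∀ p, s₃ (m p) = s₂ p.1.2) (e : E₁)
    (f : GraphModule s₃) : val (divG hm hs e f) = divVal m e (val f) := rfl

theorem norm_divG_fib_le (hm : Function.Injective m) (hs : ∀ p, s₃ (m p) = s₂ p.1.2) (e : E₁)
    (f : GraphModule s₃) (v : V) : ‖(divG hm hs e f).1 v‖ ^ 2 ≤ ‖f.1 v‖ ^ 2 := by
  obtain ⟨a, ha, h⟩ := exists_hasSum_divVal hm hs e f v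
  rwa [(hasSum_sq (divG hm hs e f) v).unique h]

end edge

variable {V : Type u} [TopologicalSpace V] [DiscreteTopology V]

theorem norm_lmulG_fib_le {E : Type v} {s : E → V} (r : E → V) (a : C₀(V, ℂ)) (x : GraphModule s)
    (v : V) : ‖(lmulG r a x).1 v‖ ≤ ‖a‖ * ‖x.1 v‖ := by
  rw [← pow_le_pow_iff_left₀ (norm_nonneg _) (by positivity) two_ne_zero, mul_pow]
  refine hasSum_le (fun e => ?_) (hasSum_sq _ v) ((hasSum_sq x v).mul_left _)
  rw [val_lmulG, norm_mul, mul_pow]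
  gcongr
  exact norm_C0_apply_le _ _

theorem norm_ipG_apply_self {E : Type v} {s : E → V} (x : GraphModule s) (v : V) :
    ipG x x v = ((‖x.1 v‖ ^ 2 : ℝ) : ℂ) := by
  rw [ipG_eq_inner, inner_self_eq_norm_sq_to_K]
  simp

/-- At a vertex `v`, the inner products `⟨a i, a i⟩` take the nonnegative values `‖(a i).1 v‖ ^ 2`,
and the norm in `C₀(V)` is a supremum over vertices. So bounds on fibres pass to finite sums with
the same constant. The bounds for creation operators and for their adjoints both come from this. -/
theorem norm_sum_ipG_le {ι : Type w} {E F : ι → Type v} {s : ∀ i, E i → V} {s' : ∀ i, F i → V}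
    (t : Finset ι) (a : ∀ i, GraphModule (s i)) (b : ∀ i, GraphModule (s' i)) {c : ℝ} (hc : 0 ≤ c)
    (h : ∀ i v, ‖(a i).1 v‖ ^ 2 ≤ c * ‖(b i).1 v‖ ^ 2) :
    ‖∑ i ∈ t, ipG (a i) (a i)‖ ≤ c * ‖∑ i ∈ t, ipG (b i) (b i)‖ := by
  have key : ∀ {E : ι → Type v} {s : ∀ i, E i → V} (a : ∀ i, GraphModule (s i)) (v : V),
      ‖(∑ i ∈ t, ipG (a i) (a i)) v‖ = ∑ i ∈ t, ‖(a i).1 v‖ ^ 2 := fun a v => by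
    have : (∑ i ∈ t, ipG (a i) (a i)) v = ((∑ i ∈ t, ‖(a i).1 v‖ ^ 2 : ℝ) : ℂ) := by
      let φ : C₀(V, ℂ) →+ ℂ := { toFun := fun a => a v, map_zero' := rfl, map_add' := fun _ _ => rfl }
      rw [Complex.ofReal_sum]
      exact (map_sum φ _ t).trans (Finset.sum_congr rfl fun i _ => norm_ipG_apply_self (a i) v)
    rw [this, Complex.norm_real, Real.norm_of_nonneg (Finset.sum_nonneg fun i _ => by positivity)]
  refine norm_C0_le _ (by positivity) fun v => ?_
  refine le_trans ?_ (mul_le_mul_of_nonneg_left (norm_C0_apply_le _ v) hc)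
  rw [key, key, Finset.mul_sum]
  exact Finset.sum_le_sum fun i _ => h i v

theorem ipG_delta_right_eq_zero {E : Type v} {s : E → V} {x : GraphModule s} {e : E}
    (h : val x e = 0) : ipG x (delta s e) = 0 := by
  ext v
  rw [ipG_apply]
  refine (tsum_congr fun e' => ?_).trans tsum_zero
  rw [val_delta]
  split_ifs with he
  · rw [he, h]
    simp
  · simp

theorem ipG_delta_self_ne_zero {E : Type v} {s : E → V} (e : E) :
    ipG (delta s e) (delta s e) ≠ 0 := fun h => by
  have := congrArg (fun a : C₀(V, ℂ) => a (s e)) h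
  simp only [ipG_delta] at this
  simp at this

theorem ipG_eq_zero_of_val {E : Type v} {s : E → V} {x y : GraphModule s}
    (h : ∀ e, val x e = 0 ∨ val y e = 0) : ipG x y = 0 := by
  ext v
  rw [ipG_apply]
  refine (tsum_congr fun e => ?_).trans tsum_zero
  rcases h e with h | h <;> simp [h]

section mul

variable {E₁ E₂ E₃ : Type v} {s₁ : E₁ → V} {r₂ s₂ : E₂ → V} {s₃ : E₃ → V}
  {m : {p : E₁ × E₂ // s₁ p.1 = r₂ p.2} → E₃}

/-- Use `⟨f g, f g⟩ = ⟨g, ⟨f, f⟩ g⟩`, the Cauchy–Schwarz inequality over `v`, and `‖⟨f, f⟩‖ = ‖f‖ ^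
2`. -/
theorem norm_mulG_fib_le (hm : Function.Injective m) (hs : ∀ p, s₃ (m p) = s₂ p.1.2)
    (f : GraphModule s₁) (g : GraphModule s₂) (v : V) :
    ‖(mulG hm hs f g).1 v‖ ^ 2 ≤ ‖f‖ ^ 2 * ‖g.1 v‖ ^ 2 := by
  have h1 : ‖ipG (mulG hm hs f g) (mulG hm hs f g) v‖ = ‖(mulG hm hs f g).1 v‖ ^ 2 := by
    rw [norm_ipG_apply_self, Complex.norm_real, Real.norm_of_nonneg (by positivity)]
  rw [← h1, ip_mulG, ipG_eq_inner]
  refine (norm_inner_le_norm _ _).trans ?_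
  have h2 := norm_lmulG_fib_le r₂ (ipG f f) g v
  rw [← norm_sq_eq] at h2
  nlinarith [norm_nonneg (g.1 v)]

/-- The product `δ_e * g` is supported on the edges `e · y`, and `divG` on the edges `y` composable
with `e`. Both sums therefore run over the same `y`, with equal terms. -/
theorem ipG_mulG_delta (hm : Function.Injective m) (hs : ∀ p, s₃ (m p) = s₂ p.1.2) (e : E₁)
    (g : GraphModule s₂) (f : GraphModule s₃) :
    ipG (mulG hm hs (delta s₁ e) g) f = ipG g (divG hm hs e f) := by
  ext v
  rw [ipG_apply, ipG_apply, ← (mulEdge_injective hm hs e v).tsum_eq,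
    ← tsum_subtype_eq_of_support_subset (s := {y : {y // s₂ y = v} | s₁ e = r₂ y})]
  · refine tsum_congr fun y => ?_
    rw [val_divG, divVal_of_eq e (val f) y.1.1 y.2, val_mulG, mulEdge, mulVal_apply hm, val_delta]
    simp
  · intro y hy
    by_contra h
    exact hy (by simp [val_divG, divVal_of_ne e (val f) y.1 h])
  · rintro ⟨z, hz⟩ hzs
    by_contra h
    refine hzs ?_
    simp only [val_mulG]
    by_cases hzr : z ∈ Set.range m
    · obtain ⟨⟨⟨x, y⟩, hxy⟩, rfl⟩ := hzr
      rw [mulVal_apply hm, val_delta, if_neg]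
      · simp
      · rintro rfl
        exact h ⟨⟨⟨y, (hs _).symm.trans hz⟩, hxy⟩, rfl⟩
    · rw [mulVal_apply' _ _ z hzr]
      simp

end mul

end GraphModule

/-! ### The Fock representation of a graph system -/

namespace GraphSystem

open GraphModule WeakPartialProductSystem HilbertSum CategoryTheory

variable {V : Type u} (G : GraphSystem.{u, v} V)

variable {G} in
-- The edge version of `ComparesFactors`; the degree of the cofactor is forced by the grading.
theorem ComparesFactors.exists_mul_eq (hG : G.ComparesFactors) {n m k l j : ℕ} (h : n + k = j)
    (h' : m + l = j) {x : G.E n} {y : G.E k} {x' : G.E m} {y' : G.E l} {hxy : G.s x = G.r y}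
    {hxy' : G.s x' = G.r y'} (he : G.mul h x y hxy = G.mul h' x' y' hxy') {d : ℕ}
    (hd : n + d = m) : ∃ (z : G.E d) (hz : G.s x = G.r z), G.mul hd x z hz = x' := by
  have hs : G.s y = G.s y' := by rw [← G.s_mul h x y hxy, he, G.s_mul]
  have hr : G.r x = G.r x' := by rw [← G.r_mul h x y hxy, he, G.r_mul]
  obtain ⟨t, ht⟩ := hG (G.arrow y hs rfl) (G.arrow x hxy rfl) (G.arrow y' rfl rfl)
    (G.arrow x' hxy' hr.symm) (by rw [G.arrow_comp h, G.arrow_comp h']; simp only [he])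
    (show n ≤ m by omega)
  obtain ⟨d', z, hz, hz', rfl⟩ := G.exists_arrow t
  have hdeg : n + d' = m := congrArg deg ht
  obtain rfl : d' = d := by omega
  rw [G.arrow_comp hd] at ht
  exact ⟨z, hxy.trans hz'.symm, G.arrow_inj ht⟩

/-- The containments of a representation say nothing when `deg x = 0` or `deg x = deg x'`. These
cases hold in every graph system: in the former `x` is an identity, and in the latter injectivity of
the multiplication gives `x = x'`. -/
theorem comparesFactors_of_exists_mul_eq
    (H : ∀ {n m k l j : ℕ} (h : n + k = j) (h' : m + l = j) {x : G.E n} {y : G.E k}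
      {x' : G.E m} {y' : G.E l} {hxy : G.s x = G.r y} {hxy' : G.s x' = G.r y'},
      G.mul h x y hxy = G.mul h' x' y' hxy' → 0 < n → ∀ {d : ℕ} (hd : n + d = m), 0 < d →
        ∃ (z : G.E d) (hz : G.s x = G.r z), G.mul hd x z hz = x') : G.ComparesFactors := by
  intro a b b' c y x y' x' hxy hd
  by_cases h0 : deg x = 0
  · obtain ⟨rfl, rfl⟩ := G.eq_of_deg_eq_zero x h0
    exact ⟨x', Category.comp_id _⟩
  obtain ⟨n, e, hb, rfl, rfl⟩ := G.exists_arrow x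
  obtain ⟨k, f, rfl, hf, rfl⟩ := G.exists_arrow y
  obtain ⟨m, e', rfl, hr, rfl⟩ := G.exists_arrow x'
  obtain ⟨l, f', hs, hf', rfl⟩ := G.exists_arrow y'
  subst hb
  have hdeg : n + k = m + l := congrArg deg hxy
  rw [G.arrow_comp hdeg, G.arrow_comp rfl] at hxy
  have he := G.arrow_inj hxy
  obtain ⟨d, rfl⟩ := Nat.exists_eq_add_of_le (show n ≤ m from hd)
  rcases Nat.eq_zero_or_pos d with rfl | hd0
  · obtain rfl : k = l := by omega
    obtain ⟨rfl, rfl⟩ := G.mul_inj _ _ _ _ _ _ _ he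
    exact ⟨𝟙 _, Category.id_comp _⟩
  · obtain ⟨z, hz, rfl⟩ := H hdeg rfl he (Nat.pos_of_ne_zero h0) rfl hd0
    exact ⟨G.arrow z (G.s_mul _ _ _ _).symm hz.symm, G.arrow_comp rfl _ _ _ _ _ _⟩

variable [TopologicalSpace V] [DiscreteTopology V]

/-- The characteristic function of an edge, as an element of the weak partial product system. -/
def edgeVec {n : ℕ} (x : G.E n) : G.toWeakPartialProductSystem.H n := delta G.s x

theorem dense_span_edgeVec (n : ℕ) :
    (Submodule.span ℂ (Set.range (G.edgeVec (n := n)))).topologicalClosure = ⊤ :=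
  dense_span_delta

theorem mul_edgeVec {n m k : ℕ} (h : n + m = k) (x : G.E n) (y : G.E m) (hxy : G.s x = G.r y) :
    G.toWeakPartialProductSystem.mul h (G.edgeVec x) (G.edgeVec y) =
      G.edgeVec (G.mul h x y hxy) := by
  refine val_ext (s := G.s) fun z => ?_
  change val (G.mulH h (delta G.s x) (delta G.s y)) z = val (delta G.s _) z
  by_cases hz : ∃ (x' : G.E n) (y' : G.E m) (hxy' : G.s x' = G.r y'), G.mul h x' y' hxy' = z
  · obtain ⟨x', y', hxy', rfl⟩ := hz
    rw [val_mulH_apply, val_delta, val_delta, val_delta]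
    by_cases hx : x' = x ∧ y' = y
    · obtain ⟨rfl, rfl⟩ := hx
      simp
    · rw [if_neg fun h' => hx (G.mul_inj _ _ _ _ _ _ _ h')]
      rcases not_and_or.1 hx with hx | hx <;> simp [hx]
  · rw [val_mulH_apply' _ _ _ _ _ fun x' y' hxy' h' => hz ⟨x', y', hxy', h'⟩, val_delta, if_neg]
    rintro rfl
    exact hz ⟨x, y, hxy, rfl⟩

theorem boundedLeftMul : G.toWeakPartialProductSystem.BoundedLeftMul := fun n x t y =>
  norm_sum_ipG_le t (fun m => G.mulH rfl x (y m)) y (by positivity)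
    fun _ v => norm_mulG_fib_le _ _ _ _ v

/-- For `δ_e` the adjoint is division by `e` in each degree, and the edges span a dense subspace. No
condition on `G` is needed. -/
theorem creation_mem_adjointable (n : ℕ) (x : G.toWeakPartialProductSystem.H n) :
    creation G.boundedLeftMul n x ∈ Adjointable C₀(V, ℂ) G.toWeakPartialProductSystem.Fock := by
  refine creation_mem_adjointable_of_dense _ (G.dense_span_edgeVec n) ?_ x
  rintro _ ⟨e, rfl⟩
  refine WeakPartialProductSystem.creation_mem_adjointable _ _
    (fun m => divG (G.mulMap_injective rfl) (fun p => G.s_mul _ _ _ p.2) e)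
    (fun m y z => ipG_mulG_delta _ _ _ _ _) fun t z => ?_
  have := norm_sum_ipG_le t (fun m => divG (G.mulMap_injective rfl)
    (fun p => G.s_mul _ _ _ p.2) e (z (n + m))) (fun m => z (n + m)) zero_le_one
    fun m v => by rw [one_mul]; exact norm_divG_fib_le _ _ _ _ v
  rwa [one_mul] at this

end GraphSystem

end

end PPS

/-! ### Representation property of the Fock representation and comparison of factors. -/

namespace PPS

noncomputable section

namespace GraphSystem

open GraphModule WeakPartialProductSystem HilbertModule HilbertSum

variable {V : Type u} [TopologicalSpace V] [DiscreteTopology V] {G : GraphSystem.{u, v} V}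

theorem ip_edgeVec_right_eq_zero {n : ℕ} {x : G.toWeakPartialProductSystem.H n} {e : G.E n}
    (h : val (s := G.s) x e = 0) : ip (A := C₀(V, ℂ)) x (G.edgeVec e) = 0 :=
  ipG_delta_right_eq_zero h

theorem ip_edgeVec_self_ne_zero {n : ℕ} (e : G.E n) :
    ip (A := C₀(V, ℂ)) (G.edgeVec e) (G.edgeVec e) ≠ 0 :=
  ipG_delta_self_ne_zero e

variable {S : ∀ n, G.toWeakPartialProductSystem.H n →ₗ[ℂ]
  Adjointable C₀(V, ℂ) G.toWeakPartialProductSystem.Fock}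

/-- An edge that does not have an edge of degree `d` as a left factor is orthogonal to the range of
the creation operators of degree `d`. -/
theorem ip_incl_edgeVec_creation (hS : G.toWeakPartialProductSystem.IsFockRepresentation S)
    {d k : ℕ} (y : G.E k) (hy : ∀ {l : ℕ} (h : d + l = k) (z : G.E d) (w : G.E l)
      (hzw : G.s z = G.r w), G.mul h z w hzw ≠ y) (f : G.toWeakPartialProductSystem.H d)
    (ξ : G.toWeakPartialProductSystem.Fock) :
    ip (A := C₀(V, ℂ)) (incl C₀(V, ℂ) G.toWeakPartialProductSystem.H k (G.edgeVec y))
      ((S d f).1 ξ) = 0 := by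
  -- The adjoint of `S d f` kills `δ_y`: every product `f · g` vanishes at `y`, since `y` does not
  -- factor in this way.
  have h0 : (star (S d f)).1
      (incl C₀(V, ℂ) G.toWeakPartialProductSystem.H k (G.edgeVec y)) = 0 := by
    refine ext_ip_incl fun l g => ?_
    rw [← isAdj_star, map_zero, hS.apply_incl rfl]
    by_cases h : d + l = k
    · subst h
      rw [ip_incl_incl]
      exact ip_edgeVec_right_eq_zero (G.val_mulH_apply' rfl f g y (hy rfl))
    · rw [ip_incl_incl_of_ne h]
  rw [← (isAdj_star (S d f)).symm, h0, map_zero, LinearMap.zero_apply]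

/-- The containment for `m > n > 0` alone suffices. It is refuted, when `x` does not divide `x'`, by
the matrix coefficient between the cofactors `y` and `y'`. -/
theorem comparesFactors_of_isPartialProductSystem
    (h : G.toWeakPartialProductSystem.IsPartialProductSystem) : G.ComparesFactors := by
  obtain ⟨S, hS, hrep⟩ := h
  refine G.comparesFactors_of_exists_mul_eq
    fun {n m k l j} h h' {x y x' y' hxy hxy'} he hn {d} hd hd0 => ?_
  by_contra! H
  let η := incl C₀(V, ℂ) G.toWeakPartialProductSystem.H k (G.edgeVec y)
  let ξ := incl C₀(V, ℂ) G.toWeakPartialProductSystem.H l (G.edgeVec y')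
  let φ : Adjointable C₀(V, ℂ) G.toWeakPartialProductSystem.Fock →ₗ[ℂ] C₀(V, ℂ) :=
    { toFun := fun T => ip (A := C₀(V, ℂ)) η (T.1 ξ)
      map_add' := fun T T' => by simp
      map_smul' := fun c T => by simp }
  have hφ : Continuous φ := by
    change Continuous fun T : Adjointable C₀(V, ℂ) G.toWeakPartialProductSystem.Fock =>
      ipL (A := C₀(V, ℂ)) η (T.1 ξ)
    fun_prop
  -- The kernel of the continuous functional `φ` is closed, so products `S (m - n) f * T` are
  -- enough; for these, `y` must have no left factor of degree `m - n`.
  have hK : closedProd (Set.range (S (m - n))) Set.univ ≤ LinearMap.ker φ := by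
    refine Submodule.topologicalClosure_minimal _ (Submodule.span_le.2 ?_)
      (isClosed_singleton.preimage hφ)
    rintro _ ⟨_, ⟨f, rfl⟩, T, -, rfl⟩
    refine ip_incl_edgeVec_creation hS y (fun {i} hi z w hzw hy => ?_) f (T.1 ξ)
    have hnd : n + (m - n) = m := by omega
    obtain rfl : d = m - n := by omega
    subst hy
    have hxz := hxy.trans (G.r_mul hi z w hzw)
    -- If `y = z · w`, then `(x · z) · w = x' · y'` with both left factors in `E m`, so injectivity
    -- gives `x · z = x'`, which is excluded.
    rw [← G.assoc hd (by omega) hi h x z w hxz hzw] at he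
    obtain rfl : i = l := by omega
    exact H z hxz (G.mul_inj _ _ _ _ _ _ _ he).1
  have hR : star (S n (G.edgeVec x)) * S m (G.edgeVec x') ∈ LinearMap.ker φ :=
    hK (hrep.lt n m hn (by omega) (Submodule.le_topologicalClosure _ (Submodule.subset_span
      ⟨_, Set.star_mem_star.2 ⟨_, rfl⟩, _, ⟨_, rfl⟩, rfl⟩)))
  have hR' : ip (A := C₀(V, ℂ)) η ((star (S n (G.edgeVec x)) * S m (G.edgeVec x')).1 ξ) = 0 := hR
  -- The same coefficient is `⟨δ_{x·y}, δ_{x'·y'}⟩`, the inner product of the vector of one edge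
  -- with itself.
  rw [ip_star_mul, hS.apply_incl h, hS.apply_incl h', ip_incl_incl, G.mul_edgeVec h x y hxy,
    G.mul_edgeVec h' x' y' hxy', ← he] at hR'
  exact ip_edgeVec_self_ne_zero _ hR'

theorem val_mulH_delta_eq_zero {n m k : ℕ} (h : n + m = k) (x : G.E n)
    (g : GraphModule (G.s (n := m))) (z : G.E k)
    (hz : ∀ (y : G.E m) (hxy : G.s x = G.r y), G.mul h x y hxy ≠ z) :
    val (G.mulH h (delta G.s x) g) z = 0 := by
  by_cases hz' : ∃ (x' : G.E n) (y : G.E m) (hxy : G.s x' = G.r y), G.mul h x' y hxy = z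
  · obtain ⟨x', y, hxy, rfl⟩ := hz'
    rw [val_mulH_apply, val_delta, if_neg, zero_mul]
    rintro rfl
    exact hz y hxy rfl
  · exact val_mulH_apply' _ _ _ _ _ fun x' y hxy h' => hz' ⟨x', y, hxy, h'⟩

/-- Creation operators of edges without common multiples have orthogonal ranges. -/
theorem star_mul_edgeVec_eq_zero (hS : G.toWeakPartialProductSystem.IsFockRepresentation S)
    {n m : ℕ} (x : G.E n) (x' : G.E m)
    (hx : ∀ {k l j : ℕ} (h : n + k = j) (h' : m + l = j) (y : G.E k) (y' : G.E l)
      (hxy : G.s x = G.r y) (hxy' : G.s x' = G.r y'), G.mul h x y hxy ≠ G.mul h' x' y' hxy') :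
    star (S n (G.edgeVec x)) * S m (G.edgeVec x') = 0 := by
  refine adjointable_ext fun i a j b => ?_
  rw [ip_star_mul]
  refine Eq.trans ?_ (map_zero _).symm
  by_cases h : n + i = m + j
  · rw [hS.apply_incl h, hS.apply_incl rfl, ip_incl_incl]
    refine ipG_eq_zero_of_val fun z => ?_
    by_cases hz : ∃ (y : G.E i) (hxy : G.s x = G.r y), G.mul h x y hxy = z
    · obtain ⟨y, hxy, rfl⟩ := hz
      exact Or.inr (val_mulH_delta_eq_zero rfl x' b _ fun y' hxy' => (hx h rfl y y' hxy hxy').symm)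
    · exact Or.inl (val_mulH_delta_eq_zero h x a _ fun y hxy h' => hz ⟨y, hxy, h'⟩)
  · rw [hS.apply_incl rfl, hS.apply_incl rfl, ip_incl_incl_of_ne h]

/-- A continuous weak representation is a representation if edges that do not divide each other
are mapped to elements with orthogonal ranges. -/
theorem isRepresentation_of_star_mul_edgeVec {B : Type w} [CStarAlgebra B]
    {ω : ∀ n, G.toWeakPartialProductSystem.H n →ₗ[ℂ] B} (hω : ∀ n, Continuous (ω n))
    (hw : G.toWeakPartialProductSystem.IsWeakRepresentation ω)
    (key : ∀ {n m d : ℕ} (hd : n + d = m) (x : G.E n) (x' : G.E m),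
      (∃ (z : G.E d) (hz : G.s x = G.r z), G.mul hd x z hz = x') ∨
        star (ω n (G.edgeVec x)) * ω m (G.edgeVec x') = 0) :
    G.toWeakPartialProductSystem.IsRepresentation ω := by
  have hmul : ∀ {n m d : ℕ} (hd : n + d = m) (x : G.E n) (z : G.E d) (hz : G.s x = G.r z),
      ω m (G.edgeVec (G.mul hd x z hz)) = ω n (G.edgeVec x) * ω d (G.edgeVec z) :=
    fun hd x z hz => by rw [hw.mul hd, G.mul_edgeVec hd x z hz]
  have hcl : ∀ X : Set B, IsClosed (closedProd X Set.univ : Set B) := fun X =>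
    Submodule.isClosed_topologicalClosure _
  have hmem : ∀ {X : Set B} {b}, b ∈ X → ∀ b', b * b' ∈ closedProd X Set.univ := fun hb b' =>
    Submodule.le_topologicalClosure _ (Submodule.subset_span ⟨_, hb, b', trivial, rfl⟩)
  refine ⟨hw, fun n m hn hnm => ?_, fun n m hm hnm => ?_⟩
  · refine closedProd_star_range_le hω (G.dense_span_edgeVec n) (G.dense_span_edgeVec m) (hcl _) ?_
    rintro _ ⟨x, rfl⟩ _ ⟨x', rfl⟩
    obtain ⟨z, hz, rfl⟩ | h0 := key (Nat.add_sub_of_le hnm.le) x x'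
    -- Here `ω(x)* ω(x · z) = ω₀(⟨x, x⟩) ω(z)` already lies in the range of `ω (m - n)`; the unit of
    -- `B` supplies the second factor.
    · rw [hmul, ← mul_assoc, hw.star_mul, hw.mul (zero_add _), ← mul_one (ω (m - n) _)]
      exact hmem (Set.mem_range_self _) 1
    · rw [h0]
      exact zero_mem _
  · refine closedProd_star_range_le hω (G.dense_span_edgeVec n) (G.dense_span_edgeVec m) (hcl _) ?_
    rintro _ ⟨x, rfl⟩ _ ⟨x', rfl⟩
    obtain ⟨z, hz, rfl⟩ | h0 := key (Nat.add_sub_of_le hnm.le) x' x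
    -- With `x = x' · z`, the factor `ω(z)*` comes out on the left, and nothing is required of the
    -- remaining factor.
    · rw [hmul, star_mul, mul_assoc]
      exact hmem (Set.star_mem_star.2 (Set.mem_range_self _)) _
    -- Now `x` has the larger degree, so `key` gives the vanishing of the adjoint product.
    · rw [← star_star (star (ω n _) * ω m _), star_mul, star_star, h0, star_zero]
      exact zero_mem _

/-- If `x` does not divide `x'` and `deg x ≤ deg x'`, then comparison of factors rules out any
common multiple `x · y = x' · y'`. So the two creation operators have orthogonal ranges. -/
theorem ComparesFactors.isPartialProductSystem (hG : G.ComparesFactors) :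
    G.toWeakPartialProductSystem.IsPartialProductSystem := by
  have hS := isFockRepresentation_fock G.boundedLeftMul G.creation_mem_adjointable
  refine ⟨_, hS, isRepresentation_of_star_mul_edgeVec
    (continuous_fock G.boundedLeftMul G.creation_mem_adjointable) hS.isWeakRepresentation
    fun {n m d} hd x x' => ?_⟩
  by_cases h : ∃ (z : G.E d) (hz : G.s x = G.r z), G.mul hd x z hz = x'
  · exact Or.inl h
  · exact Or.inr (star_mul_edgeVec_eq_zero hS x x' fun h1 h2 y y' hxy hxy' he =>
      h (hG.exists_mul_eq h1 h2 he hd))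

end GraphSystem

end

end PPS

/-- The cycle of implications runs from partial product systems to weighted path categories, on to
path categories by forgetting the weights, and back. -/
theorem mainTheorem9 {V : Type u} [TopologicalSpace V] [DiscreteTopology V]
    (G : PPS.GraphSystem.{u, v} V) :
    (G.toWeakPartialProductSystem.IsPartialProductSystem ↔ G.IsPathCategory) ∧
      (G.toWeakPartialProductSystem.IsPartialProductSystem ↔ G.IsWeightedPathCategory) := by
  have h : G.toWeakPartialProductSystem.IsPartialProductSystem → G.IsWeightedPathCategory :=
    fun h => PPS.GraphSystem.ComparesFactors.isWeightedPathCategory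
      (PPS.GraphSystem.comparesFactors_of_isPartialProductSystem h)
  have h' : G.IsPathCategory → G.toWeakPartialProductSystem.IsPartialProductSystem :=
    fun h => PPS.GraphSystem.ComparesFactors.isPartialProductSystem h.comparesFactors
  exact ⟨⟨fun H => (h H).isPathCategory, h'⟩, ⟨h, fun H => h' H.isPathCategory⟩⟩
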